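/- Let $X$ be either the $k$-regular tree with $k\ge 3$, or a bi-regular tree with degrees $k_0,k_1\ge 3$, i.e. the vertices are split into two classes $X_0,X_1$, vertices of $X_i$ have degree $k_i$, and every edge joins $X_0$ to $X_1$. Give $\mathrm{Aut}(X)$ the topology of pointwise convergence, and let $G$ be a closed subgroup of $\mathrm{Aut}(X)$ such that * $G$ acts transitively on the vertices in the regular case, and any two vertices of the same class are related by an element of $G$ in the bi-regular case; * the action is locally $\infty$-transitive: for every vertex $x$ and every $n\ge 1$ the stabilizer $G_x$ acts transitively on the sphere $\{y : d(x,y)=n\}$. Let $\Gamma$ be a lattice in $G$, i.e. a discrete subgroup such that $\Gamma\backslash G$ carries a nonzero finite $G$-invariant regular Borel measure, and fix such a measure $m$. We say that $L^2(\Gamma\backslash G)$ has a spectral gap if the representation of $G$ by right translations on $L^2_0(\Gamma\backslash G,m)=\{\xi\in L^2(\Gamma\backslash G,m):\int\xi\,dm=0\}$ has no almost invariant vectors, that is, if it is not true that for every compact $Q\subset G$ and every $\varepsilon>0$ there is a unit vector $\xi$ with $\|g\xi-\xi\|<\varepsilon$ for all $g\in Q$. Let $D=\Gamma\backslash X$ be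 the quotient graph, with vertex set $VD$, and oriented edges $e$ (from $\partial_0e$ to $\partial_1e$) the $\Gamma$-orbits of oriented edges of $X$, with $\mu(x)=1/|\Gamma_x|$ for a vertex $x$, $\mu(e)=1/|\Gamma_e|$ for an oriented edge $e$, and $i(e)=[\Gamma_{\partial_0e}:\Gamma_e]$. Put $\mathrm{indeg}(x)=\sum_{\partial_0e=x}i(e)$ and $$\Delta f(x)=f(x)-\frac1{\mathrm{indeg}(x)}\sum_{\partial_0e=x}\frac{\mu(e)}{\mu(x)}f(\partial_1e),\qquad f\in L^2(VD,\mu),$$ and let $\lambda(D)=\inf\big(\sigma(\Delta)\setminus\{0\}\big)$, where $\sigma(\Delta)$ is the spectrum of $\Delta$ on $L^2(VD,\mu)$ and $\inf\emptyset=+\infty$. Then $D$ has finite volume, $\sum_{x\in VD}\mu(x)<\infty$, and $$L^2(\Gamma\backslash G)\text{ has a spectral gap}\iff\lambda(D)>0 .$$ Moreover, if $\mathrm{indeg}$ is constant (the case of a regular tree), then the spectral gap is also equivalent to the positivity of $\inf\langle\Delta f,f\rangle$ over all unit vectors $f$ of $L^2_0(VD,\mu)=\{f\in L^2(VD,\mu):\sum_x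 f(x)\mu(x)=0\}$ (with $\inf\emptyset=+\infty$). -/

import Mathlib

noncomputable section

namespace TreeLattice

/-! ### Lattices and the regular representation on `L²(Γ\G)` -/

section Lattices

open MeasureTheory

variable {G : Type*} [Group G]

/-- The space `Γ\G` of cosets `Γg`. -/
def RightCosets (Γ : Subgroup G) : Type _ := Quotient (QuotientGroup.rightRel Γ)

/-- Right translation `Γx ↦ Γxg` on `Γ\G`. -/
def RightCosets.translate (Γ : Subgroup G) (g : G) : RightCosets Γ → RightCosets Γ :=
  Quotient.map (fun x => x * g) (by
    intro a b h
    have h' := QuotientGroup.rightRel_apply.mp h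
    exact QuotientGroup.rightRel_apply.mpr (by simpa [mul_assoc] using h'))

theorem RightCosets.translate_one (Γ : Subgroup G) :
    RightCosets.translate Γ 1 = id := by
  funext x
  induction x using Quotient.inductionOn with
  | _ a => exact congrArg (Quotient.mk _) (mul_one a)

theorem RightCosets.translate_mul (Γ : Subgroup G) (g h : G) :
    RightCosets.translate Γ (g * h) = RightCosets.translate Γ h ∘ RightCosets.translate Γ g := by
  funext x
  induction x using Quotient.inductionOn with
  | _ a => exact congrArg (Quotient.mk _) (mul_assoc a g h).symm

/-- A representation `π` on a normed space has almost invariant vectors: for every compact `Q`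
and every `ε > 0` there is a unit vector moved by less than `ε` by all elements of `Q`. -/
def HasAlmostInvariantVectors [TopologicalSpace G] {H : Type*} [NormedAddCommGroup H]
    [NormedSpace ℂ H] (π : Representation ℂ G H) : Prop :=
  ∀ Q : Set G, IsCompact Q → ∀ ε : ℝ, 0 < ε →
    ∃ ξ : H, ‖ξ‖ = 1 ∧ ∀ g ∈ Q, ‖π g ξ - ξ‖ < ε

variable [TopologicalSpace G]

/-- The quotient topology on `Γ\G`. -/
instance (Γ : Subgroup G) : TopologicalSpace (RightCosets Γ) :=
  inferInstanceAs (TopologicalSpace (Quotient (QuotientGroup.rightRel Γ)))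

/-- The Borel σ-algebra on `Γ\G`. -/
instance (Γ : Subgroup G) : MeasurableSpace (RightCosets Γ) := borel _

instance (Γ : Subgroup G) : BorelSpace (RightCosets Γ) := ⟨rfl⟩

/-- `μ` is a nonzero finite `G`-invariant regular Borel measure on `Γ\G`. -/
structure IsFiniteInvariantMeasure (Γ : Subgroup G) (μ : Measure (RightCosets Γ)) : Prop where
  finite : IsFiniteMeasure μ
  ne_zero : μ ≠ 0
  regular : μ.Regular
  invariant : ∀ g : G, MeasurePreserving (RightCosets.translate Γ g) μ μ

/-- A lattice: a discrete subgroup `Γ` such that `Γ\G` carries a nonzero finite `G`-invariant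
regular Borel measure. -/
structure IsLattice (Γ : Subgroup G) : Prop where
  discrete : DiscreteTopology Γ
  exists_measure : ∃ μ : Measure (RightCosets Γ), IsFiniteInvariantMeasure Γ μ

variable {Γ : Subgroup G} {μ : Measure (RightCosets Γ)}

/-- The representation `ρ` of `G` on `L²(Γ\G, μ)` by right translations,
`(ρ(g)ξ)(x) = ξ(xg)`. -/
def rho (hμ : IsFiniteInvariantMeasure Γ μ) : Representation ℂ G (Lp ℂ 2 μ) where
  toFun g := Lp.compMeasurePreservingₗ ℂ (RightCosets.translate Γ g) (hμ.invariant g)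
  map_one' := by
    ext1 ξ
    have key : ∀ (f : RightCosets Γ → RightCosets Γ) (hf : MeasurePreserving f μ μ), f = id →
        Lp.compMeasurePreserving f hf ξ = ξ := by
      rintro f hf rfl
      exact Lp.compMeasurePreserving_id_apply ξ
    exact key _ _ (RightCosets.translate_one Γ)
  map_mul' g h := by
    ext1 ξ
    have key : ∀ (f : RightCosets Γ → RightCosets Γ) (hf : MeasurePreserving f μ μ),
        f = RightCosets.translate Γ h ∘ RightCosets.translate Γ g →
        Lp.compMeasurePreserving f hf ξ =
          Lp.compMeasurePreserving _ (hμ.invariant g)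
            (Lp.compMeasurePreserving _ (hμ.invariant h) ξ) := by
      rintro f hf rfl
      exact Lp.compMeasurePreserving_comp_apply ξ (hμ.invariant h) (hμ.invariant g)
    exact key _ _ (RightCosets.translate_mul Γ g h)

theorem integrable_of_L2 (hμ : IsFiniteInvariantMeasure Γ μ) (ξ : Lp ℂ 2 μ) :
    Integrable (ξ : RightCosets Γ → ℂ) μ := by
  have := hμ.finite
  exact (Lp.memLp ξ).integrable (by norm_num)

/-- `L²₀(Γ\G, μ)`, the functions of integral zero, as a subrepresentation of `ρ`. -/
def L20 (hμ : IsFiniteInvariantMeasure Γ μ) : Subrepresentation (rho hμ) where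
  toSubmodule :=
    { carrier := {ξ | ∫ x, ξ x ∂μ = 0}
      zero_mem' := by
        change ∫ x, (0 : Lp ℂ 2 μ) x ∂μ = 0
        rw [integral_congr_ae (Lp.coeFn_zero ℂ 2 μ)]
        simp
      add_mem' := by
        intro ξ η hξ hη
        change ∫ x, (ξ + η) x ∂μ = 0
        rw [integral_congr_ae (Lp.coeFn_add ξ η)]
        change ∫ x, (ξ x + η x) ∂μ = 0
        rw [integral_add (integrable_of_L2 hμ ξ) (integrable_of_L2 hμ η), hξ, hη, add_zero]
      smul_mem' := by
        intro c ξ hξ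
        change ∫ x, (c • ξ) x ∂μ = 0
        rw [integral_congr_ae (Lp.coeFn_smul c ξ)]
        change ∫ x, c • ξ x ∂μ = 0
        rw [integral_smul, hξ, smul_zero] }
  apply_mem_toSubmodule := by
    intro g ξ hξ
    have hT := hμ.invariant g
    change ∫ x, (Lp.compMeasurePreserving (RightCosets.translate Γ g) hT ξ) x ∂μ = 0
    rw [integral_congr_ae (Lp.coeFn_compMeasurePreserving ξ hT)]
    have h2 := integral_map (μ := μ) hT.measurable.aemeasurable
      (f := (ξ : RightCosets Γ → ℂ)) (by rw [hT.map_eq]; exact Lp.aestronglyMeasurable ξ)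
    rw [hT.map_eq] at h2
    exact h2.symm.trans hξ

/-- The representation `ρ⁰` of `G` on `L²₀(Γ\G, μ)`. -/
def rho0 (hμ : IsFiniteInvariantMeasure Γ μ) :
    Representation ℂ G (L20 hμ).toSubmodule :=
  (L20 hμ).toRepresentation

/-- `L²(Γ\G, μ)` has a spectral gap: `ρ⁰` has no almost invariant vectors. -/
def HasSpectralGap (hμ : IsFiniteInvariantMeasure Γ μ) : Prop :=
  ¬ HasAlmostInvariantVectors (rho0 hμ)

end Lattices

/-! ### Diagrams and their Laplacian -/

/-- An edge-indexed locally finite graph with a measure. Vertices `V`, oriented edges `E`,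
origin `src`, terminus `tgt`, edge reversal `rev`, weights `i`, and a measure given by `μV` on
vertices and `μE` on edges. An edge may be equal to its own reverse; in a quotient of a tree this
happens exactly for the edges that are inverted by the group. -/
structure Diagram (V E : Type*) where
  src : E → V
  tgt : E → V
  rev : E → E
  rev_rev : ∀ e, rev (rev e) = e
  src_rev : ∀ e, src (rev e) = tgt e
  finite_star : ∀ x, {e | src e = x}.Finite
  i : E → ℝ
  i_pos : ∀ e, 0 < i e
  μV : V → ℝ
  μV_pos : ∀ x, 0 < μV x
  μE : E → ℝ
  μE_pos : ∀ e, 0 < μE e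
  i_mul_μV : ∀ e, i e * μV (src e) = μE e
  μE_rev : ∀ e, μE (rev e) = μE e

namespace Diagram

variable {V E : Type*} (D : Diagram V E)

/-- The total mass of the vertices is finite. -/
def HasFiniteVolume : Prop := Summable D.μV

/-- The oriented edges with origin `x`. -/
def star (x : V) : Finset E := (D.finite_star x).toFinset

/-- The in-degree of a vertex. -/
def indeg (x : V) : ℝ := ∑ e ∈ D.star x, D.i e

/-- `D` is `k`-regular. -/
def IsRegular (k : ℝ) : Prop := ∀ x, D.indeg x = k

/-- The Laplace operator
`Δf(x) = f(x) - (1 / indeg x) ∑_{∂₀e = x} (μ(e) / μ(x)) f(∂₁e)`. -/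
def laplacian (f : V → ℂ) (x : V) : ℂ :=
  f x - 1 / (D.indeg x : ℂ) * ∑ e ∈ D.star x, ((D.μE e / D.μV x : ℝ) : ℂ) * f (D.tgt e)

/-- `f` belongs to `L²(VD, μ)`. -/
def MemL2 (f : V → ℂ) : Prop := Summable fun x => ‖f x‖ ^ 2 * D.μV x

/-- The inner product `⟨f, g⟩ = ∑ f(x) conj(g(x)) μ(x)`. -/
def inner (f g : V → ℂ) : ℂ := ∑' x, f x * (starRingEnd ℂ) (g x) * (D.μV x : ℂ)

/-- The spectrum of `Δ` on `L²(VD, μ)`: those `z` for which `z - Δ` is not a bijection from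
`{f ∈ L² : Δf ∈ L²}` onto `L²`. -/
def spectrum : Set ℂ :=
  {z | ¬ ∀ g : V → ℂ, D.MemL2 g →
    ∃! f : V → ℂ, D.MemL2 f ∧ ∀ x, z * f x - D.laplacian f x = g x}

/-- The bottom `inf (σ(Δ) \ {0})` of the nonzero spectrum (the infimum of the empty set is `⊤`). -/
def lambda : EReal :=
  sInf {t : EReal | ∃ r : ℝ, (r : ℂ) ∈ D.spectrum ∧ r ≠ 0 ∧ t = (r : EReal)}

/-- The infimum of `⟨Δf, f⟩` over the unit sphere of
`L²₀(VD, μ) = {f ∈ L²(VD, μ) : ⟨f, 1⟩ = 0}` (the infimum of the empty set is `⊤`). -/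
def rayleigh : EReal :=
  sInf {t : EReal | ∃ f : V → ℂ, D.MemL2 f ∧ D.inner f 1 = 0 ∧ D.inner f f = 1 ∧
    t = ((D.inner (D.laplacian f) f).re : EReal)}

end Diagram

/-! ### Groups of automorphisms of a tree -/

section Trees

variable {V : Type*} {X : SimpleGraph V}

/-- The topology of pointwise convergence on `Aut(X)`, with `X` discrete. -/
instance autTopology : TopologicalSpace (X ≃g X) :=
  TopologicalSpace.induced (fun g : X ≃g X => (g : V → V))
    (@Pi.topologicalSpace V (fun _ => V) fun _ => ⊥)

/-- The action of `Aut(X)` on oriented edges. -/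
instance dartAction : MulAction (X ≃g X) X.Dart where
  smul g d := ⟨(g d.fst, g d.snd), g.map_adj_iff.mpr d.adj⟩
  one_smul _ := rfl
  mul_smul _ _ _ := rfl

/-- The action of `G` on `X` is locally `∞`-transitive: every vertex stabilizer acts transitively
on every sphere around the vertex. -/
def LocallyInftyTransitive (G : Subgroup (X ≃g X)) : Prop :=
  ∀ x : V, ∀ n : ℕ, 1 ≤ n → ∀ y z : V, X.dist x y = n → X.dist x z = n →
    ∃ g ∈ G, g x = x ∧ g y = z

/-- `G` is transitive on the vertices that lie in `S`. -/
def TransitiveOn (G : Subgroup (X ≃g X)) (S : Set V) : Prop :=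
  ∀ x ∈ S, ∀ y ∈ S, ∃ g ∈ G, g x = y

/-- `X` is bi-regular with vertex classes `S` (degree `k₀`) and `Sᶜ` (degree `k₁`), and every
edge joins the two classes. -/
structure IsBiregular (X : SimpleGraph V) [X.LocallyFinite] (S : Set V) (k₀ k₁ : ℕ) : Prop where
  degree_of_mem : ∀ x ∈ S, X.degree x = k₀
  degree_of_notMem : ∀ x ∉ S, X.degree x = k₁
  mem_iff_of_adj : ∀ x y, X.Adj x y → (x ∈ S ↔ y ∉ S)

variable {G : Subgroup (X ≃g X)} (Γ : Subgroup G)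

theorem fst_smul (γ : Γ) (d : X.Dart) : (γ • d).fst = γ • d.fst := rfl

theorem snd_smul (γ : Γ) (d : X.Dart) : (γ • d).snd = γ • d.snd := rfl

theorem symm_smul (γ : Γ) (d : X.Dart) : (γ • d).symm = γ • d.symm := rfl

theorem finite_walk_sphere (X : SimpleGraph V) [X.LocallyFinite] (n : ℕ) :
    ∀ x : V, {y | ∃ w : X.Walk x y, w.length = n}.Finite := by
  induction n with
  | zero =>
    intro x
    refine (Set.finite_singleton x).subset ?_
    rintro y ⟨w, hw⟩
    exact (SimpleGraph.Walk.eq_of_length_eq_zero hw).symm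
  | succ n ih =>
    intro x
    have hfin : (X.neighborSet x).Finite := Set.toFinite _
    refine (hfin.biUnion fun z _ => ih z).subset ?_
    rintro y ⟨w, hw⟩
    cases w with
    | nil => simp at hw
    | cons h p =>
      simp only [SimpleGraph.Walk.length_cons, Nat.add_right_cancel_iff] at hw
      exact Set.mem_biUnion (show _ ∈ X.neighborSet x from h) ⟨p, hw⟩

/-- A discrete group is separated from the identity by finitely many vertices. -/
theorem exists_finite_separating (hΓ : DiscreteTopology Γ) :
    ∃ F : Finset V, ∀ γ : Γ, (∀ v ∈ F, γ • v = v) → γ = 1 := by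
  let _ : TopologicalSpace V := ⊥
  have : DiscreteTopology V := ⟨rfl⟩
  have hind : Topology.IsInducing (fun (γ : Γ) (v : V) => γ • v) := by
    have h1 : Topology.IsInducing (fun g : X ≃g X => (g : V → V)) := ⟨rfl⟩
    exact h1.comp (Topology.IsInducing.subtypeVal.comp Topology.IsInducing.subtypeVal)
  have hopen : IsOpen ({1} : Set Γ) := isOpen_discrete _
  obtain ⟨O, hO, hO1⟩ := hind.isOpen_iff.mp hopen
  have h1O : (fun v : V => (1 : Γ) • v) ∈ O := by
    have : (1 : Γ) ∈ (fun (γ : Γ) (v : V) => γ • v) ⁻¹' O := by rw [hO1]; rfl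
    exact this
  obtain ⟨F, u, hu, hsub⟩ := isOpen_pi_iff.mp hO _ h1O
  refine ⟨F, fun γ hγ => ?_⟩
  have : γ ∈ (fun (γ : Γ) (v : V) => γ • v) ⁻¹' O := by
    refine hsub fun v hv => ?_
    have h2 := (hu v hv).2
    simp only [one_smul] at h2
    change γ • v ∈ u v
    rw [hγ v hv]
    exact h2
  rw [hO1] at this
  exact this

theorem finite_stabilizer [X.LocallyFinite] (hX : X.Connected) (hΓ : DiscreteTopology Γ) (x : V) :
    Finite (MulAction.stabilizer Γ x) := by
  obtain ⟨F, hF⟩ := exists_finite_separating Γ hΓ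
  have hw : ∀ v : V, ∃ w : X.Walk x v, True := fun v => ⟨(hX.preconnected x v).some, trivial⟩
  choose w _ using hw
  let S : F → Set V := fun v => {y | ∃ p : X.Walk x y, p.length = (w v).length}
  have : ∀ v : F, Finite (S v) := fun v => (finite_walk_sphere X _ x).to_subtype
  have hmem : ∀ (γ : MulAction.stabilizer Γ x) (v : F), (γ : Γ) • (v : V) ∈ S v := by
    intro γ v
    have hγ : ((γ : Γ) : X ≃g X) x = x := γ.2
    exact ⟨((w v).map (((γ : Γ) : X ≃g X) : X →g X)).copy hγ rfl, by simp⟩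
  let φ : MulAction.stabilizer Γ x → (∀ v : F, S v) := fun γ v => ⟨_, hmem γ v⟩
  refine Finite.of_injective φ fun γ δ h => ?_
  have hone : (δ : Γ)⁻¹ * (γ : Γ) = 1 := by
    refine hF _ fun v hv => ?_
    have h3 := congrArg Subtype.val (congrFun h ⟨v, hv⟩)
    have h4 : (γ : Γ) • v = (δ : Γ) • v := h3
    rw [mul_smul, h4, inv_smul_smul]
  exact Subtype.ext (inv_mul_eq_one.mp hone).symm

/-- The stabilizer of an oriented edge fixes its origin. -/
theorem stabilizer_dart_le (d : X.Dart) :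
    MulAction.stabilizer Γ d ≤ MulAction.stabilizer Γ d.fst := by
  intro γ hγ
  exact congrArg (fun d : X.Dart => d.fst) (MulAction.mem_stabilizer_iff.mp hγ)

theorem stabilizer_symm (d : X.Dart) :
    MulAction.stabilizer Γ d.symm = MulAction.stabilizer Γ d := by
  ext γ
  simp only [MulAction.mem_stabilizer_iff, ← symm_smul]
  exact SimpleGraph.Dart.symm_involutive.injective.eq_iff

theorem relIndex_mul_card (d : X.Dart) :
    (MulAction.stabilizer Γ d).relIndex (MulAction.stabilizer Γ d.fst) *
      Nat.card (MulAction.stabilizer Γ d) = Nat.card (MulAction.stabilizer Γ d.fst) := by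
  have h := Subgroup.index_mul_card
    ((MulAction.stabilizer Γ d).subgroupOf (MulAction.stabilizer Γ d.fst))
  rw [Nat.card_congr (Subgroup.subgroupOfEquivOfLe (stabilizer_dart_le Γ d)).toEquiv] at h
  exact h

theorem card_stabilizer_congr {A : Type*} [MulAction Γ A] {a b : A}
    (h : (MulAction.orbitRel Γ A) a b) :
    Nat.card (MulAction.stabilizer Γ a) = Nat.card (MulAction.stabilizer Γ b) :=
  Nat.card_congr (MulAction.stabilizerEquivStabilizerOfOrbitRel h).toEquiv

/-- The vertices of `Γ\X`. -/
abbrev QuotV : Type _ := MulAction.orbitRel.Quotient Γ V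

/-- The oriented edges of `Γ\X`. -/
abbrev QuotE : Type _ := MulAction.orbitRel.Quotient Γ X.Dart

/-- The diagram `D = Γ\X` of a discrete group `Γ`, with `i(e) = [Γ_x : Γ_e]` for `x = ∂₀e`,
`μ(x) = 1 / |Γ_x|` and `μ(e) = 1 / |Γ_e|`, where `Γ_e` is the stabilizer of the oriented edge
`e`. -/
def quotientDiagram [X.LocallyFinite] (hX : X.Connected) (hΓ : DiscreteTopology Γ) :
    Diagram (QuotV Γ) (QuotE Γ) where
  src := Quotient.map (fun d : X.Dart => d.fst) (by
    rintro a b ⟨γ, rfl⟩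
    exact ⟨γ, rfl⟩)
  tgt := Quotient.map (fun d : X.Dart => d.snd) (by
    rintro a b ⟨γ, rfl⟩
    exact ⟨γ, rfl⟩)
  rev := Quotient.map (fun d : X.Dart => d.symm) (by
    rintro a b ⟨γ, rfl⟩
    exact ⟨γ, rfl⟩)
  rev_rev e := by
    induction e using Quotient.inductionOn with
    | _ d => exact congrArg (Quotient.mk _) d.symm_symm
  src_rev e := by
    induction e using Quotient.inductionOn with
    | _ d => rfl
  finite_star x := by
    induction x using Quotient.inductionOn with
    | _ v =>
      have hfin : (X.neighborSet v).Finite := Set.toFinite _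
      have := hfin.to_subtype
      refine (Set.finite_range fun w : X.neighborSet v =>
        (Quotient.mk _ (⟨(v, w.1), w.2⟩ : X.Dart) : QuotE Γ)).subset ?_
      intro e
      induction e using Quotient.inductionOn with
      | _ d =>
        intro hd
        obtain ⟨γ, hγ⟩ := Quotient.exact (show (Quotient.mk _ d.fst : QuotV Γ) = _ from hd)
        obtain ⟨δ, hδ⟩ : ∃ δ : Γ, δ • d.fst = v := by
          refine ⟨γ⁻¹, ?_⟩
          rw [inv_smul_eq_iff]
          exact hγ.symm
        refine ⟨⟨(δ • d).snd, ?_⟩, ?_⟩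
        · have := (δ • d).adj
          rw [fst_smul, hδ] at this
          exact this
        · refine Quotient.sound ⟨δ, ?_⟩
          apply SimpleGraph.Dart.ext
          exact Prod.ext hδ rfl
  i := Quotient.lift
    (fun d : X.Dart =>
      ((MulAction.stabilizer Γ d).relIndex (MulAction.stabilizer Γ d.fst) : ℝ)) (by
    intro a b h
    have hf : (MulAction.orbitRel Γ V) a.fst b.fst := by
      obtain ⟨γ, rfl⟩ := h
      exact ⟨γ, rfl⟩
    have h1 := relIndex_mul_card Γ a
    have h2 := relIndex_mul_card Γ b
    rw [card_stabilizer_congr Γ h, card_stabilizer_congr Γ hf, ← h2] at h1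
    have := finite_stabilizer Γ hX hΓ b.fst
    have : Finite (MulAction.stabilizer Γ b) :=
      Finite.of_injective _ (Subgroup.inclusion_injective (stabilizer_dart_le Γ b))
    exact congrArg Nat.cast (Nat.eq_of_mul_eq_mul_right Nat.card_pos h1))
  i_pos e := by
    induction e using Quotient.inductionOn with
    | _ d =>
      have := finite_stabilizer Γ hX hΓ d.fst
      have h := relIndex_mul_card Γ d
      have hpos : 0 < Nat.card (MulAction.stabilizer Γ d.fst) := Nat.card_pos
      rw [← h] at hpos
      exact Nat.cast_pos.mpr (Nat.pos_of_mul_pos_right hpos)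
  μV := Quotient.lift (fun v : V => 1 / (Nat.card (MulAction.stabilizer Γ v) : ℝ)) (by
    intro a b h
    simp only [card_stabilizer_congr Γ h])
  μV_pos x := by
    induction x using Quotient.inductionOn with
    | _ v =>
      have := finite_stabilizer Γ hX hΓ v
      exact one_div_pos.mpr (Nat.cast_pos.mpr Nat.card_pos)
  μE := Quotient.lift (fun d : X.Dart => 1 / (Nat.card (MulAction.stabilizer Γ d) : ℝ)) (by
    intro a b h
    simp only [card_stabilizer_congr Γ h])
  μE_pos e := by
    induction e using Quotient.inductionOn with
    | _ d =>
      have := finite_stabilizer Γ hX hΓ d.fst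
      have : Finite (MulAction.stabilizer Γ d) :=
        Finite.of_injective _ (Subgroup.inclusion_injective (stabilizer_dart_le Γ d))
      exact one_div_pos.mpr (Nat.cast_pos.mpr Nat.card_pos)
  i_mul_μV e := by
    induction e using Quotient.inductionOn with
    | _ d =>
      have := finite_stabilizer Γ hX hΓ d.fst
      have : Finite (MulAction.stabilizer Γ d) :=
        Finite.of_injective _ (Subgroup.inclusion_injective (stabilizer_dart_le Γ d))
      have h := relIndex_mul_card Γ d
      have h1 : (Nat.card (MulAction.stabilizer Γ d.fst) : ℝ) ≠ 0 :=
        Nat.cast_ne_zero.mpr Nat.card_pos.ne'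
      have h2 : (Nat.card (MulAction.stabilizer Γ d) : ℝ) ≠ 0 :=
        Nat.cast_ne_zero.mpr Nat.card_pos.ne'
      change ((MulAction.stabilizer Γ d).relIndex (MulAction.stabilizer Γ d.fst) : ℝ) *
        (1 / (Nat.card (MulAction.stabilizer Γ d.fst) : ℝ)) =
        1 / (Nat.card (MulAction.stabilizer Γ d) : ℝ)
      rw [mul_one_div, div_eq_div_iff h1 h2, one_mul]
      exact_mod_cast h
  μE_rev e := by
    induction e using Quotient.inductionOn with
    | _ d =>
      change 1 / (Nat.card (MulAction.stabilizer Γ d.symm) : ℝ) =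
        1 / (Nat.card (MulAction.stabilizer Γ d) : ℝ)
      rw [stabilizer_symm]

end Trees

end TreeLattice

end

open TreeLattice

/-!
The spectral gap of `L²(Γ\G)` and the gap of the Laplacian of `D = Γ\X` are both equivalent to a
Poincaré inequality on `D` (`Diagram.Poincare`): the distance of a function `f` to the constants, in
the `L²`-norm with weight `indeg(x) μ(x)`, is at most a multiple of the `L²`-norm of its gradient
`f(∂₀e) - f(∂₁e)`, with weight `μ(e)`.

*The Laplacian.* Let `S f = f ∘ ∂₀` and `T f = f ∘ ∂₁`, two isometries from `L²` of the vertices to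
`L²` of the oriented edges. Then `Δ = 1 - S†T`, which is self-adjoint because edge reversal exchanges
`S` and `T`, and `⟨Δf, f⟩` is half the square norm of `Sf - Tf`. As `D` is connected, the kernel of
`Δ` consists of the constants. Hence the Poincaré inequality says that `Δ` is bounded below by a
positive number on the complement of its kernel, which by the functional calculus means that `0` is
isolated in the spectrum (`Diagram.lambda_pos_iff`). In the regular case the weight `indeg(x) μ(x)` is
a multiple of `μ(x)`, and the inequality is a statement on Rayleigh quotients
(`Diagram.rayleigh_pos_iff`). The weights `indeg(x) μ(x)` and `μ(x)` define the same square integrable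
functions, since the degrees of `X` are bounded.

*The measure.* Fix an edge from `x₀` to `x₁` in `X`, and consider the maps `p₀ : Γg ↦ Γgx₀` and
`p₁ : Γg ↦ Γgx₁` from `Γ\G` to the vertices of `D`. The images of the invariant measure under
`Γg ↦ Γg(x₀, x₁)` and `Γg ↦ Γg(x₁, x₀)` add up to a positive multiple of the measure `μ(e)`
(`exists_map_add_map_eq`). Indeed the stabilizer of `x₀` permutes the edges at `x₀` transitively, so
that the mass of `e` for the first map is `i(e) / deg(x₀)` times the mass of its origin; thus the sum
of the two masses, divided by `μ(e)`, depends only on the origin of `e`, and since it is invariant under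
edge reversal it is constant. This already gives the finite volume, and it shows that the norms in the
Poincaré inequality are comparable to norms of `f ∘ p₀`, `f ∘ p₁` and `f ∘ p₀ - f ∘ p₁` on `Γ\G`.

*From a spectral gap to the Poincaré inequality.* An element `g` with `d(x₀, gx₀) = n` moves `f ∘ p₀` by
at most `n` times the norm of `f ∘ p₀ - f ∘ p₁`, because `G` is transitive on edges up to reversal. As
this is bounded for `g` in a compact set, the spectral gap bounds the distance of `f ∘ p₀` to the
constants (`poincare_of_hasSpectralGap`).

*From the Poincaré inequality to a spectral gap.* The stabilizers of `x₀` and `x₁` are compact. A vector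
that is almost invariant under them can be approximated by functions invariant under small open
subgroups and averaged, so it is close to functions `f₀ ∘ p₀` and `f₁ ∘ p₁`. If some `h` in `G` maps
`x₀` to `x₁`, almost invariance under `h` allows to take `f₁ = f₀`; otherwise `p₀` and `p₁` have disjoint
ranges and `f₀`, `f₁` are parts of one function `f`. The gradient of `f` is small, so by the Poincaré
inequality the vector is almost constant (`hasSpectralGap_of_poincare`).
-/

noncomputable section

open MeasureTheory
open scoped ENNReal NNReal Topology InnerProductSpace

namespace TreeLattice

/-! ### Spectral gaps of self-adjoint operators -/

section Hilbert

variable {H : Type*} [NormedAddCommGroup H] [InnerProductSpace ℂ H] [CompleteSpace H]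

/-- If `0` is isolated in the spectrum of a self-adjoint operator `L` and the rest of the spectrum
lies in `[c, ∞)`, then `L ≥ c` on the orthogonal complement of its kernel. -/
theorem gap_of_spectrum {L : H →L[ℂ] H} (hL : IsSelfAdjoint L) {c : ℝ} (hc : 0 < c)
    (hspec : ∀ r ∈ spectrum ℝ L, r = 0 ∨ c ≤ r) (f : H)
    (hf : ∀ u, L u = 0 → ⟪u, f⟫_ℂ = 0) : c * ‖f‖ ^ 2 ≤ (⟪L f, f⟫_ℂ).re := by
  classical
  -- `δ` is the indicator function of `{0}`; it is continuous on the spectrum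
  let δ : ℝ → ℝ := fun x => if x = 0 then 1 else 0
  have hδ : ContinuousOn δ (spectrum ℝ L) := by
    intro x hx
    have hev : ∀ᶠ y in nhdsWithin x (spectrum ℝ L), δ y = δ x := by
      rcases hspec x hx with rfl | h
      · filter_upwards [self_mem_nhdsWithin, mem_nhdsWithin_of_mem_nhds (Iio_mem_nhds hc)]
          with y hy hyc
        rcases hspec y hy with rfl | h'
        · rfl
        · exact absurd hyc (not_lt.mpr h')
      · filter_upwards [mem_nhdsWithin_of_mem_nhds (Ioi_mem_nhds (hc.trans_le h))] with y hy
        have h1 : y ≠ 0 := ne_of_gt hy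
        have h2 : x ≠ 0 := (hc.trans_le h).ne'
        simp [δ, h1, h2]
    exact (continuousWithinAt_const (b := δ x)).congr_of_eventuallyEq hev rfl
  have hker : L * cfc δ L = 0 := by
    have h1 := cfc_mul (fun x : ℝ => x) δ L (by fun_prop) hδ
    have h2 : (fun x : ℝ => x * δ x) = fun _ => 0 := by
      funext x
      by_cases h : x = 0 <;> simp [δ, h]
    rw [cfc_id' ℝ L, h2, cfc_const_zero ℝ L] at h1
    exact h1.symm
  have hle : cfc (fun x => c * (1 - δ x)) L ≤ L := by
    conv_rhs => rw [← cfc_id' ℝ L]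
    refine cfc_mono (fun x hx => ?_) (by fun_prop) (by fun_prop)
    rcases hspec x hx with rfl | h
    · simp [δ]
    · simpa [δ, (hc.trans_le h).ne'] using h
  have hdec : cfc (fun x => c * (1 - δ x)) L = c • (1 - cfc δ L) := by
    rw [cfc_const_mul c (fun x => 1 - δ x) L (by fun_prop),
      cfc_sub (fun _ => 1) δ L (by fun_prop) hδ, cfc_const_one ℝ L]
  rw [hdec, ContinuousLinearMap.le_def] at hle
  have hpos := hle.re_inner_nonneg_left f
  have horth : ⟪cfc δ L f, f⟫_ℂ = 0 :=
    hf _ (by simpa using congrArg (fun T : H →L[ℂ] H => T f) hker)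
  have hself : (⟪f, f⟫_ℂ).re = ‖f‖ ^ 2 := by
    rw [inner_self_eq_norm_sq_to_K, ← Complex.ofReal_re (‖f‖ ^ 2)]; norm_cast
  have hcalc : ⟪(L - c • (1 - cfc δ L)) f, f⟫_ℂ = ⟪L f, f⟫_ℂ - c * ⟪f, f⟫_ℂ := by
    have : (L - c • (1 - cfc δ L)) f = L f - (c : ℂ) • (f - cfc δ L f) := by simp
    rw [this, inner_sub_left, inner_smul_left, inner_sub_left, horth]
    simp
  rw [hcalc] at hpos
  have : RCLike.re (⟪L f, f⟫_ℂ - c * ⟪f, f⟫_ℂ) = (⟪L f, f⟫_ℂ).re - c * ‖f‖ ^ 2 := by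
    rw [← hself]; simp
  linarith [this ▸ hpos]

/-- If `H` splits orthogonally into the kernel of the self-adjoint operator `L` and a part on which
`L ≥ c`, then `r - L` is invertible for every nonzero `r < c`. -/
theorem isUnit_sub_of_gap {L : H →L[ℂ] H} (hL : IsSelfAdjoint L) {c : ℝ}
    (hgap : ∀ f, ∃ u v, f = u + v ∧ L u = 0 ∧ ⟪u, v⟫_ℂ = 0 ∧ c * ‖v‖ ^ 2 ≤ (⟪L v, v⟫_ℂ).re)
    {r : ℝ} (hr : r ≠ 0) (hrc : r < c) : IsUnit (algebraMap ℝ (H →L[ℂ] H) r - L) := by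
  set B := algebraMap ℝ (H →L[ℂ] H) r - L with hB
  have hBapp : ∀ f, B f = (r : ℂ) • f - L f := fun f => by
    simp [hB, Algebra.algebraMap_eq_smul_one]
  have hBsa : IsSelfAdjoint B := (IsSelfAdjoint.algebraMap _ (IsSelfAdjoint.all r)).sub hL
  have hsym : ∀ a b, ⟪B a, b⟫_ℂ = ⟪a, B b⟫_ℂ := hBsa.isSymmetric
  have hLsym : ∀ a b, ⟪L a, b⟫_ℂ = ⟪a, L b⟫_ℂ := hL.isSymmetric
  -- `d` bounds `r - L` below on the kernel and on its complement
  set d := min |r| (c - r) with hd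
  have hd0 : 0 < d := lt_min (abs_pos.mpr hr) (by linarith)
  have hbound : ∀ f, d ^ 2 * ‖f‖ ^ 2 ≤ ‖B f‖ ^ 2 := by
    intro f
    obtain ⟨u, v, rfl, hu, huv, hv⟩ := hgap f
    have hBu : B u = (r : ℂ) • u := by rw [hBapp, hu, sub_zero]
    have h1 : ⟪B u, B v⟫_ℂ = 0 := by
      rw [hBu, hBapp, inner_smul_left, inner_sub_right, inner_smul_right, huv, ← hLsym, hu]
      simp
    have h2 : ‖B (u + v)‖ ^ 2 = ‖B u‖ ^ 2 + ‖B v‖ ^ 2 := by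
      rw [map_add, sq, sq, sq, norm_add_sq_eq_norm_sq_add_norm_sq_of_inner_eq_zero _ _ h1]
    have h3 : ‖u + v‖ ^ 2 = ‖u‖ ^ 2 + ‖v‖ ^ 2 := by
      rw [sq, sq, sq, norm_add_sq_eq_norm_sq_add_norm_sq_of_inner_eq_zero _ _ huv]
    have h4 : ‖B u‖ = |r| * ‖u‖ := by rw [hBu, norm_smul]; simp
    have h5 : (c - r) * ‖v‖ ≤ ‖B v‖ := by
      rcases eq_or_ne v 0 with rfl | hv0
      · simp
      have h6 : (c - r) * ‖v‖ ^ 2 ≤ ‖B v‖ * ‖v‖ := by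
        have h7 := (abs_le.mp ((Complex.abs_re_le_norm _).trans (norm_inner_le_norm (𝕜 := ℂ) (B v) v))).1
        have h8 : (⟪B v, v⟫_ℂ).re = r * ‖v‖ ^ 2 - (⟪L v, v⟫_ℂ).re := by
          rw [hBapp, inner_sub_left, inner_smul_left, inner_self_eq_norm_sq_to_K]
          simp [← Complex.ofReal_pow]
        nlinarith
      have : 0 < ‖v‖ := norm_pos_iff.mpr hv0
      nlinarith
    have h9 : (d * ‖u‖) ^ 2 ≤ (|r| * ‖u‖) ^ 2 := by
      gcongr; exact min_le_left _ _
    have h10 : (d * ‖v‖) ^ 2 ≤ ‖B v‖ ^ 2 := by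
      refine pow_le_pow_left₀ (by positivity) (le_trans ?_ h5) 2
      gcongr; exact min_le_right _ _
    rw [h2, h3, h4]
    nlinarith
  -- `B` is self-adjoint and bounded below, so its square is coercive
  have hBB : IsUnit (B * B) := by
    refine ContinuousLinearMap.isUnit_of_forall_le_norm_inner_map (B * B)
      (c := ⟨d ^ 2, by positivity⟩) (by exact_mod_cast (by positivity : 0 < d ^ 2)) fun f => ?_
    have : ⟪(B * B) f, f⟫_ℂ = ((‖B f‖ ^ 2 : ℝ) : ℂ) := by
      change ⟪B (B f), f⟫_ℂ = _
      rw [hsym, inner_self_eq_norm_sq_to_K]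
      norm_cast
    rw [this, Complex.norm_real, Real.norm_of_nonneg (by positivity)]
    change ‖f‖ ^ 2 * d ^ 2 ≤ _
    linarith [hbound f]
  rw [← sq] at hBB
  exact (isUnit_pow_iff two_ne_zero).mp hBB

end Hilbert

/-! ### The Laplacian of a diagram as a self-adjoint operator -/

namespace Diagram

variable {V E : Type*} (D : Diagram V E)

theorem mem_star {x : V} {e : E} : e ∈ D.star x ↔ D.src e = x := by simp [star]

theorem indeg_nonneg (x : V) : 0 ≤ D.indeg x := Finset.sum_nonneg fun e _ => (D.i_pos e).le

theorem sum_μE_star (x : V) : ∑ e ∈ D.star x, D.μE e = D.indeg x * D.μV x := by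
  rw [indeg, Finset.sum_mul]
  refine Finset.sum_congr rfl fun e he => ?_
  rw [← D.i_mul_μV, D.mem_star.mp he]

theorem src_comp_rev : D.src ∘ D.rev = D.tgt := funext D.src_rev

theorem tgt_comp_rev : D.tgt ∘ D.rev = D.src := by
  funext e
  rw [Function.comp_apply, ← D.src_rev, D.rev_rev]

variable [MeasurableSpace E]

/-- The measure on oriented edges that gives mass `μ(e)` to `e`. -/
def edgeMeasure : Measure E := Measure.sum fun e => ENNReal.ofReal (D.μE e) • Measure.dirac e

variable [DiscreteMeasurableSpace E]

theorem edgeMeasure_singleton (e : E) : D.edgeMeasure {e} = ENNReal.ofReal (D.μE e) := by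
  rw [edgeMeasure, Measure.sum_apply _ (.of_discrete), tsum_eq_single e]
  · simp
  · intro e' he'
    simp [he']

theorem edgeMeasure_singleton_ne_zero (e : E) : D.edgeMeasure {e} ≠ 0 := by
  simp [edgeMeasure_singleton, D.μE_pos e]

theorem ae_edgeMeasure {p : E → Prop} : (∀ᵐ e ∂D.edgeMeasure, p e) ↔ ∀ e, p e := by
  refine ⟨fun h e => ?_, fun h => .of_forall h⟩
  by_contra hp
  exact D.edgeMeasure_singleton_ne_zero e
    (measure_mono_null (fun e' he' => by rw [show e' = e from he']; exact hp) h)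

theorem measurePreserving_rev [Countable E] :
    MeasurePreserving D.rev D.edgeMeasure D.edgeMeasure := by
  refine ⟨.of_discrete, Measure.ext_of_singleton fun e => ?_⟩
  have : D.rev ⁻¹' {e} = {D.rev e} := by
    ext e'
    exact ⟨fun h => by rw [← D.rev_rev e', show D.rev e' = e from h]; rfl,
      fun h => by rw [show e' = D.rev e from h]; exact D.rev_rev e⟩
  rw [Measure.map_apply (.of_discrete) (.of_discrete), this, edgeMeasure_singleton,
    edgeMeasure_singleton, D.μE_rev]

variable [MeasurableSpace V]


/-- The measure on vertices that gives mass `indeg(x) μ(x)` to `x`. It is the image of the measure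
on edges under the origin map, and the Laplacian is symmetric for it. -/
def vertexMeasure : Measure V := D.edgeMeasure.map D.src

theorem measurePreserving_src : MeasurePreserving D.src D.edgeMeasure D.vertexMeasure :=
  ⟨.of_discrete, rfl⟩

theorem measurePreserving_tgt [Countable E] :
    MeasurePreserving D.tgt D.edgeMeasure D.vertexMeasure := by
  rw [← D.src_comp_rev]
  exact D.measurePreserving_src.comp D.measurePreserving_rev

/-- The Hilbert space of square integrable functions on the vertices, for the measure
`indeg(x) μ(x)`. -/
abbrev VertexL2 : Type _ := Lp ℂ 2 D.vertexMeasure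

/-- The Hilbert space of square integrable functions on the oriented edges. -/
abbrev EdgeL2 : Type _ := Lp ℂ 2 D.edgeMeasure

/-- The isometry `f ↦ f ∘ ∂₀`. -/
def pullSrc : D.VertexL2 →ₗᵢ[ℂ] D.EdgeL2 :=
  Lp.compMeasurePreservingₗᵢ ℂ D.src D.measurePreserving_src

theorem pullSrc_coe (f : D.VertexL2) : D.pullSrc f =ᵐ[D.edgeMeasure] fun e => f (D.src e) :=
  Lp.coeFn_compMeasurePreserving f D.measurePreserving_src

theorem vertexMeasure_singleton [DiscreteMeasurableSpace V] (x : V) :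
    D.vertexMeasure {x} = ENNReal.ofReal (D.indeg x * D.μV x) := by
  have : D.src ⁻¹' {x} = (D.star x : Set E) := by ext e; simp [D.mem_star]
  rw [vertexMeasure, Measure.map_apply (.of_discrete) (.of_discrete), this,
    ← sum_measure_singleton, ← sum_μE_star, ENNReal.ofReal_sum_of_nonneg fun e _ => (D.μE_pos e).le]
  simp [edgeMeasure_singleton]

variable [Countable E]

/-- The isometry `f ↦ f ∘ ∂₁`. -/
def pullTgt : D.VertexL2 →ₗᵢ[ℂ] D.EdgeL2 :=
  Lp.compMeasurePreservingₗᵢ ℂ D.tgt D.measurePreserving_tgt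

/-- The isometry of `L²` of the oriented edges induced by edge reversal. -/
def pullRev : D.EdgeL2 →ₗᵢ[ℂ] D.EdgeL2 :=
  Lp.compMeasurePreservingₗᵢ ℂ D.rev D.measurePreserving_rev

theorem pullRev_pullSrc (f : D.VertexL2) : D.pullRev (D.pullSrc f) = D.pullTgt f := by
  have key : ∀ (t : E → V) (ht : MeasurePreserving t D.edgeMeasure D.vertexMeasure),
      t = D.src ∘ D.rev → D.pullRev (D.pullSrc f) = Lp.compMeasurePreservingₗᵢ ℂ t ht f := by
    rintro t ht rfl
    exact (Lp.compMeasurePreserving_comp_apply f D.measurePreserving_src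
      D.measurePreserving_rev).symm
  exact key _ _ D.src_comp_rev.symm

theorem pullRev_pullTgt (f : D.VertexL2) : D.pullRev (D.pullTgt f) = D.pullSrc f := by
  have key : ∀ (t : E → V) (ht : MeasurePreserving t D.edgeMeasure D.vertexMeasure),
      t = D.tgt ∘ D.rev → D.pullRev (D.pullTgt f) = Lp.compMeasurePreservingₗᵢ ℂ t ht f := by
    rintro t ht rfl
    exact (Lp.compMeasurePreserving_comp_apply f D.measurePreserving_tgt
      D.measurePreserving_rev).symm
  exact key _ _ D.tgt_comp_rev.symm

/-- The Markov operator `f ↦ f - Δf`, written as `(∂₀^*)† ∘ ∂₁^*`. -/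
def markov : D.VertexL2 →L[ℂ] D.VertexL2 :=
  ContinuousLinearMap.adjoint D.pullSrc.toContinuousLinearMap ∘L D.pullTgt.toContinuousLinearMap

theorem inner_markov (f g : D.VertexL2) :
    ⟪g, D.markov f⟫_ℂ = ⟪D.pullSrc g, D.pullTgt f⟫_ℂ :=
  ContinuousLinearMap.adjoint_inner_right D.pullSrc.toContinuousLinearMap _ _

theorem inner_markov_left (f g : D.VertexL2) :
    ⟪D.markov f, g⟫_ℂ = ⟪D.pullTgt f, D.pullSrc g⟫_ℂ :=
  ContinuousLinearMap.adjoint_inner_left D.pullSrc.toContinuousLinearMap _ _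

/-- The Laplace operator on `L²` of the vertices. -/
def laplaceOp : D.VertexL2 →L[ℂ] D.VertexL2 := 1 - D.markov

theorem isSelfAdjoint_laplaceOp : IsSelfAdjoint D.laplaceOp := by
  refine (IsSelfAdjoint.one _).sub ?_
  rw [ContinuousLinearMap.isSelfAdjoint_iff_isSymmetric]
  intro f g
  change ⟪D.markov f, g⟫_ℂ = ⟪f, D.markov g⟫_ℂ
  rw [inner_markov, inner_markov_left, ← D.pullRev_pullSrc f, ← D.pullRev_pullTgt g,
    LinearIsometry.inner_map_map]

/-- The Dirichlet form of `Δ` is half the square norm of the gradient. -/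
theorem re_inner_laplaceOp (f : D.VertexL2) :
    (⟪D.laplaceOp f, f⟫_ℂ).re = ‖D.pullSrc f - D.pullTgt f‖ ^ 2 / 2 := by
  have h1 : ⟪D.laplaceOp f, f⟫_ℂ = ⟪f, f⟫_ℂ - ⟪D.pullTgt f, D.pullSrc f⟫_ℂ := by
    rw [← inner_markov_left, ← inner_sub_left]; rfl
  have h2 := norm_sub_sq (𝕜 := ℂ) (D.pullTgt f) (D.pullSrc f)
  have h3 : (⟪f, f⟫_ℂ).re = ‖f‖ ^ 2 := by
    rw [inner_self_eq_norm_sq_to_K, ← Complex.ofReal_re (‖f‖ ^ 2)]; norm_cast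
  rw [norm_sub_rev] at h2
  simp only [LinearIsometry.norm_map, RCLike.re_to_complex] at h2
  rw [h1, Complex.sub_re, h3, h2]
  ring

theorem pullTgt_coe (f : D.VertexL2) : D.pullTgt f =ᵐ[D.edgeMeasure] fun e => f (D.tgt e) :=
  Lp.coeFn_compMeasurePreserving f D.measurePreserving_tgt

/-- Functions in the kernel of `Δ` are constant along edges. -/
theorem eq_of_laplaceOp_eq_zero {f : D.VertexL2} (hf : D.laplaceOp f = 0) (e : E) :
    f (D.src e) = f (D.tgt e) := by
  have h := D.re_inner_laplaceOp f
  rw [hf, inner_zero_left, Complex.zero_re] at h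
  have h0 : ‖D.pullSrc f - D.pullTgt f‖ = 0 := by
    have : ‖D.pullSrc f - D.pullTgt f‖ ^ 2 = 0 := by linarith
    simpa using this
  have h1 : D.pullSrc f = D.pullTgt f := sub_eq_zero.mp (norm_eq_zero.mp h0)
  have h2 := D.pullSrc_coe f
  rw [h1] at h2
  exact D.ae_edgeMeasure.mp (h2.symm.trans (D.pullTgt_coe f)) e


/-! ### Comparison with functions on the vertices -/

variable {V E : Type*} (D : Diagram V E) [MeasurableSpace E] [MeasurableSpace V]

variable {D} in
theorem vertexL2_ext {F F' : D.VertexL2} (h : ∀ x, F x = F' x) : F = F' :=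
  Lp.ext (.of_forall h)

variable [DiscreteMeasurableSpace E] [DiscreteMeasurableSpace V]

theorem vertexMeasure_singleton_ne_top (x : V) : D.vertexMeasure {x} ≠ ∞ := by
  simp [vertexMeasure_singleton]

theorem vertexMeasure_real_singleton (x : V) :
    D.vertexMeasure.real {x} = D.indeg x * D.μV x := by
  rw [measureReal_def, vertexMeasure_singleton,
    ENNReal.toReal_ofReal (mul_nonneg (D.indeg_nonneg x) (D.μV_pos x).le)]

variable {D}

theorem ae_vertexMeasure (hpos : ∀ x, 0 < D.indeg x) {p : V → Prop} :
    (∀ᵐ x ∂D.vertexMeasure, p x) ↔ ∀ x, p x := by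
  refine ⟨fun h x => ?_, fun h => .of_forall h⟩
  by_contra hp
  have h0 : D.vertexMeasure {x} = 0 :=
    measure_mono_null (fun y hy => by rw [show y = x from hy]; exact hp) h
  rw [vertexMeasure_singleton, ENNReal.ofReal_eq_zero] at h0
  exact absurd h0 (not_le.mpr (mul_pos (hpos x) (D.μV_pos x)))

theorem coe_toLp (hpos : ∀ x, 0 < D.indeg x) {f : V → ℂ} (hf : MemLp f 2 D.vertexMeasure) (x : V) :
    hf.toLp f x = f x :=
  (ae_vertexMeasure hpos).mp hf.coeFn_toLp x

/-- The operator `laplaceOp` is given by the formula that defines the Laplacian of a diagram. -/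
theorem laplaceOp_apply [Countable E] (hpos : ∀ x, 0 < D.indeg x) (F : D.VertexL2) (x : V) :
    D.laplaceOp F x = D.laplacian F x := by
  have hm : MeasurableSet ({x} : Set V) := .of_discrete
  have hx := D.vertexMeasure_singleton_ne_top x
  have hpre : D.src ⁻¹' {x} = (D.star x : Set E) := by ext e; simp [D.mem_star]
  -- the value at `x` is found by pairing with the indicator function of `{x}`
  have h1 := D.inner_markov F (indicatorConstLp 2 hm hx 1)
  have h2 : D.pullSrc (indicatorConstLp 2 hm hx (1 : ℂ)) =
      indicatorConstLp 2 (D.measurePreserving_src.measurable hm)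
        (by rwa [D.measurePreserving_src.measure_preimage hm.nullMeasurableSet]) 1 :=
    Lp.indicatorConstLp_compMeasurePreserving hm hx 1 D.measurePreserving_src
  rw [h2, L2.inner_indicatorConstLp_one, L2.inner_indicatorConstLp_one, integral_singleton,
    setIntegral_congr_ae (g := fun e => F (D.tgt e)) (D.measurePreserving_src.measurable hm)
      (by filter_upwards [D.pullTgt_coe F] with e he _ using he), hpre,
    setIntegral_finset, vertexMeasure_real_singleton] at h1
  · have h3 : D.laplaceOp F x = F x - D.markov F x :=
      (ae_vertexMeasure hpos).mp (Lp.coeFn_sub F (D.markov F)) x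
    have h4 : (D.indeg x : ℂ) ≠ 0 := by exact_mod_cast (hpos x).ne'
    have h5 : (D.μV x : ℂ) ≠ 0 := by exact_mod_cast (D.μV_pos x).ne'
    have h6 : D.markov F x =
        1 / (D.indeg x : ℂ) * ∑ e ∈ D.star x, ((D.μE e / D.μV x : ℝ) : ℂ) * F (D.tgt e) := by
      have h7 : ∑ e ∈ D.star x, ((D.μE e / D.μV x : ℝ) : ℂ) * F (D.tgt e) =
          1 / (D.μV x : ℂ) * ∑ e ∈ D.star x, D.edgeMeasure.real {e} • F (D.tgt e) := by
        rw [Finset.mul_sum]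
        refine Finset.sum_congr rfl fun e _ => ?_
        rw [measureReal_def, edgeMeasure_singleton, ENNReal.toReal_ofReal (D.μE_pos e).le,
          Complex.real_smul]
        push_cast
        ring
      rw [h7, ← h1, Complex.real_smul]
      push_cast
      field_simp
    rw [h3, h6, laplacian]
  · rw [← Set.biUnion_of_singleton (D.star x : Set E)]
    simp [integrableOn_finset_iUnion, edgeMeasure_singleton]

variable [Countable V]

theorem memL2_iff {a b : ℝ} (ha : 0 < a) (hab : ∀ x, a ≤ D.indeg x ∧ D.indeg x ≤ b) (f : V → ℂ) :
    D.MemL2 f ↔ MemLp f 2 D.vertexMeasure := by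
  rw [memLp_two_iff_integrable_sq_norm (by fun_prop)]
  have hμ : D.vertexMeasure = Measure.sum fun x =>
      ENNReal.ofReal (D.indeg x * D.μV x) • Measure.dirac x := by
    refine Measure.ext_of_singleton fun x => ?_
    rw [vertexMeasure_singleton, Measure.sum_apply _ (.of_discrete), tsum_eq_single x]
    · simp
    · intro e' he'
      simp [he']
  have hW : ∀ x, 0 ≤ D.indeg x * D.μV x := fun x => mul_nonneg (D.indeg_nonneg x) (D.μV_pos x).le
  have h1 : Integrable (fun x => ‖f x‖ ^ 2) D.vertexMeasure ↔
      Summable fun x => ‖f x‖ ^ 2 * (D.indeg x * D.μV x) := by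
    rw [hμ, integrable_sum_dirac_iff]
    · refine summable_congr fun x => ?_
      rw [ENNReal.toReal_ofReal (hW x)]
      simp [mul_comm]
    · simp
  rw [h1, MemL2]
  constructor
  · intro h
    refine Summable.of_nonneg_of_le (fun x => mul_nonneg (by positivity) (hW x)) (fun x => ?_)
      (h.mul_left b)
    have := mul_le_mul_of_nonneg_left (hab x).2
      (mul_nonneg (sq_nonneg ‖f x‖) (D.μV_pos x).le)
    linarith
  · intro h
    refine Summable.of_nonneg_of_le (fun x => mul_nonneg (by positivity) (D.μV_pos x).le)
      (fun x => ?_) (h.mul_left a⁻¹)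
    have := mul_le_mul_of_nonneg_left (hab x).1
      (mul_nonneg (sq_nonneg ‖f x‖) (D.μV_pos x).le)
    rw [le_inv_mul_iff₀ ha]
    linarith

/-- For real numbers, the spectrum of a diagram is the spectrum of the operator `laplaceOp`. The
weights `μ` and `indeg · μ` define the same square integrable functions. -/
theorem mem_spectrum_iff [Countable E] {a b : ℝ} (ha : 0 < a)
    (hab : ∀ x, a ≤ D.indeg x ∧ D.indeg x ≤ b) (r : ℝ) :
    (r : ℂ) ∈ D.spectrum ↔ r ∈ _root_.spectrum ℝ D.laplaceOp := by
  have hpos : ∀ x, 0 < D.indeg x := fun x => ha.trans_le (hab x).1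
  rw [spectrum.mem_iff, ContinuousLinearMap.isUnit_iff_bijective, Function.bijective_iff_existsUnique]
  refine not_congr ?_
  have happ : ∀ (F : D.VertexL2) (x : V),
      (algebraMap ℝ (D.VertexL2 →L[ℂ] D.VertexL2) r - D.laplaceOp) F x =
        r * F x - D.laplacian F x := by
    intro F x
    have h1 : (algebraMap ℝ (D.VertexL2 →L[ℂ] D.VertexL2) r - D.laplaceOp) F =
        (r : ℂ) • F - D.laplaceOp F := by
      rw [Algebra.algebraMap_eq_smul_one]
      rfl
    rw [h1, (ae_vertexMeasure hpos).mp (Lp.coeFn_sub _ _) x, Pi.sub_apply,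
      (ae_vertexMeasure hpos).mp (Lp.coeFn_smul (r : ℂ) F) x, laplaceOp_apply hpos]
    rfl
  constructor
  · intro h G
    obtain ⟨f, ⟨hf, hfG⟩, huniq⟩ := h G ((memL2_iff ha hab _).mpr (Lp.memLp G))
    have hf' := (memL2_iff ha hab _).mp hf
    have hcoe : (hf'.toLp f : V → ℂ) = f := funext (coe_toLp hpos hf')
    refine ⟨hf'.toLp f, vertexL2_ext fun x => ?_, fun F hF => vertexL2_ext fun x => ?_⟩
    · rw [happ, hcoe]
      exact hfG x
    · rw [hcoe, ← huniq F ⟨(memL2_iff ha hab _).mpr (Lp.memLp F), fun x => ?_⟩]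
      rw [← happ, hF]
  · intro h g hg
    have hg' := (memL2_iff ha hab _).mp hg
    obtain ⟨F, hF, huniq⟩ := h (hg'.toLp g)
    refine ⟨F, ⟨(memL2_iff ha hab _).mpr (Lp.memLp F), fun x => ?_⟩, fun f hf => ?_⟩
    · rw [← happ, hF, coe_toLp hpos]
    · have hf' := (memL2_iff ha hab _).mp hf.1
      have hcoe : (hf'.toLp f : V → ℂ) = f := funext (coe_toLp hpos hf')
      rw [← hcoe, huniq (hf'.toLp f) (vertexL2_ext fun x => ?_)]
      rw [happ, hcoe, hf.2 x, coe_toLp hpos]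


/-! ### The Poincaré inequality of a diagram -/

variable {V E : Type*} (D : Diagram V E) [MeasurableSpace V] [MeasurableSpace E]

/-- The Poincaré inequality: the distance of `f` from the constants is controlled by its
gradient. -/
def Poincare : Prop :=
  ∃ C : ℝ≥0, ∀ f : V → ℂ, MemLp f 2 D.vertexMeasure → ∃ a : ℂ,
    eLpNorm (fun x => f x - a) 2 D.vertexMeasure ≤
      C * eLpNorm (fun e => f (D.src e) - f (D.tgt e)) 2 D.edgeMeasure

variable {D}

theorem enorm_gradient [DiscreteMeasurableSpace E] [Countable E] (F : D.VertexL2) :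
    ‖D.pullSrc F - D.pullTgt F‖ₑ =
      eLpNorm (fun e => F (D.src e) - F (D.tgt e)) 2 D.edgeMeasure := by
  rw [Lp.enorm_def]
  refine eLpNorm_congr_ae ?_
  filter_upwards [Lp.coeFn_sub (D.pullSrc F) (D.pullTgt F), D.pullSrc_coe F, D.pullTgt_coe F]
    with e h1 h2 h3
  rw [h1, Pi.sub_apply, h2, h3]

theorem inner_eq [DiscreteMeasurableSpace V] [DiscreteMeasurableSpace E] [Countable V]
    {k : ℝ} (hk : 0 < k) (hreg : D.IsRegular k) (F G : D.VertexL2) :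
    D.inner F G = ⟪G, F⟫_ℂ / k := by
  have hk' : (k : ℂ) ≠ 0 := by exact_mod_cast hk.ne'
  rw [eq_div_iff hk', L2.inner_def, integral_countable (L2.integrable_inner G F), inner,
    ← tsum_mul_right]
  refine tsum_congr fun x => ?_
  rw [vertexMeasure_real_singleton, hreg x, Complex.real_smul]
  simp only [RCLike.inner_apply]
  push_cast
  ring

variable [IsFiniteMeasure D.vertexMeasure]

variable (D) in
/-- The constant function `1`, as an element of `L²` of the vertices. -/
def one : D.VertexL2 := Lp.const 2 D.vertexMeasure (1 : ℂ)

theorem exists_add_smul_one (F : D.VertexL2) :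
    ∃ (a : ℂ) (F₀ : D.VertexL2), F = a • D.one + F₀ ∧ ⟪D.one, F₀⟫_ℂ = 0 := by
  obtain ⟨u, hu, v, hv, rfl⟩ :=
    (Submodule.span ℂ {D.one}).exists_add_mem_mem_orthogonal F
  obtain ⟨a, rfl⟩ := Submodule.mem_span_singleton.mp hu
  exact ⟨a, v, rfl, (Submodule.mem_orthogonal_singleton_iff_inner_right).mp hv⟩

theorem one_apply [DiscreteMeasurableSpace V] [DiscreteMeasurableSpace E]
    (hpos : ∀ x, 0 < D.indeg x) (x : V) : D.one x = 1 :=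
  (ae_vertexMeasure hpos).mp (Lp.coeFn_const (p := 2) (μ := D.vertexMeasure) (1 : ℂ)) x

variable [DiscreteMeasurableSpace V] [DiscreteMeasurableSpace E] [Countable E]

variable (D) in
/-- The Poincaré inequality on the orthogonal complement of the constants, with the square of the
norm of the gradient. -/
def HasGap : Prop :=
  ∃ c : ℝ, 0 < c ∧ ∀ F : D.VertexL2, ⟪D.one, F⟫_ℂ = 0 →
    c * ‖F‖ ^ 2 ≤ ‖D.pullSrc F - D.pullTgt F‖ ^ 2

theorem pullSrc_one (hpos : ∀ x, 0 < D.indeg x) : D.pullSrc D.one = D.pullTgt D.one := by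
  refine Lp.ext ?_
  filter_upwards [D.pullSrc_coe D.one, D.pullTgt_coe D.one] with e h1 h2
  rw [h1, h2, one_apply hpos, one_apply hpos]

theorem laplaceOp_one (hpos : ∀ x, 0 < D.indeg x) : D.laplaceOp D.one = 0 := by
  refine ext_inner_left ℂ fun g => ?_
  have : ⟪g, D.laplaceOp D.one⟫_ℂ = ⟪g, D.one⟫_ℂ - ⟪D.pullSrc g, D.pullTgt D.one⟫_ℂ := by
    rw [← inner_markov, ← inner_sub_right]; rfl
  rw [this, ← pullSrc_one hpos, LinearIsometry.inner_map_map, sub_self, inner_zero_right]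

theorem hasGap_iff_poincare (hpos : ∀ x, 0 < D.indeg x) : D.HasGap ↔ D.Poincare := by
  have hsub : ∀ (F : D.VertexL2) (a : ℂ),
      ‖F - a • D.one‖ₑ = eLpNorm (fun x => F x - a) 2 D.vertexMeasure := by
    intro F a
    rw [Lp.enorm_def]
    refine eLpNorm_congr_ae ((ae_vertexMeasure hpos).mpr fun x => ?_)
    rw [(ae_vertexMeasure hpos).mp (Lp.coeFn_sub _ _) x, Pi.sub_apply,
      (ae_vertexMeasure hpos).mp (Lp.coeFn_smul a D.one) x, Pi.smul_apply, one_apply hpos,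
      smul_eq_mul, mul_one]
  constructor
  · rintro ⟨c, hc, h⟩
    refine ⟨(√c)⁻¹.toNNReal, fun f hf => ?_⟩
    set F := hf.toLp f
    have hcoe : (F : V → ℂ) = f := funext (coe_toLp hpos hf)
    obtain ⟨a, F₀, hF, hF₀⟩ := exists_add_smul_one F
    refine ⟨a, ?_⟩
    have h1 := hsub F a
    have h2 := enorm_gradient F
    rw [hcoe] at h1 h2
    rw [← h1, ← h2]
    have h3 : F - a • D.one = F₀ := by rw [hF]; abel
    have h4 : D.pullSrc F - D.pullTgt F = D.pullSrc F₀ - D.pullTgt F₀ := by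
      rw [hF, map_add, map_add, map_smul, map_smul, pullSrc_one hpos]; abel
    rw [h3, h4, ← ofReal_norm, ← ofReal_norm, ← ENNReal.ofReal_coe_nnreal,
      Real.coe_toNNReal _ (by positivity), ← ENNReal.ofReal_mul (by positivity)]
    refine ENNReal.ofReal_le_ofReal ?_
    rw [le_inv_mul_iff₀ (Real.sqrt_pos.mpr hc)]
    refine le_of_sq_le_sq ?_ (norm_nonneg _)
    rw [mul_pow, Real.sq_sqrt hc.le]
    exact h F₀ hF₀
  · rintro ⟨C, h⟩
    refine ⟨((C + 1 : ℝ) ^ 2)⁻¹, by positivity, fun F hF => ?_⟩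
    obtain ⟨a, ha⟩ := h F (Lp.memLp F)
    rw [← hsub, ← enorm_gradient, ← ofReal_norm, ← ofReal_norm, ← ENNReal.ofReal_coe_nnreal,
      ← ENNReal.ofReal_mul (by positivity), ENNReal.ofReal_le_ofReal_iff (by positivity)] at ha
    have h1 : ‖F‖ ≤ ‖F - a • D.one‖ := by
      have h2 : ⟪F, a • D.one⟫_ℂ = 0 := by
        rw [inner_smul_right, inner_eq_zero_symm.mp hF, mul_zero]
      have h4 : ‖F - a • D.one‖ ^ 2 = ‖F‖ ^ 2 + ‖a • D.one‖ ^ 2 := by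
        rw [@norm_sub_sq ℂ, h2]; simp
      refine le_of_sq_le_sq ?_ (norm_nonneg _)
      rw [h4]
      nlinarith [sq_nonneg ‖a • D.one‖]
    rw [inv_mul_le_iff₀ (by positivity), ← mul_pow]
    refine pow_le_pow_left₀ (norm_nonneg _) ((h1.trans ha).trans ?_) 2
    gcongr
    linarith

variable [Countable V]

/-- The bottom of the nonzero spectrum of `Δ` is positive if and only if the Poincaré inequality
holds. -/
theorem lambda_pos_iff {a b : ℝ} (ha : 0 < a) (hab : ∀ x, a ≤ D.indeg x ∧ D.indeg x ≤ b)
    (hconn : ∀ f : V → ℂ, (∀ e, f (D.src e) = f (D.tgt e)) → ∀ x y, f x = f y) :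
    0 < D.lambda ↔ D.Poincare := by
  have hpos : ∀ x, 0 < D.indeg x := fun x => ha.trans_le (hab x).1
  rw [← hasGap_iff_poincare hpos]
  constructor
  · intro h
    obtain ⟨c, hc0, hc⟩ := EReal.lt_iff_exists_real_btwn.mp h
    have hc0 : 0 < c := EReal.coe_pos.mp hc0
    have hspec : ∀ r ∈ _root_.spectrum ℝ D.laplaceOp, r = 0 ∨ c ≤ r := by
      intro r hr
      refine or_iff_not_imp_left.mpr fun hr0 => ?_
      have : D.lambda ≤ (r : EReal) := sInf_le ⟨r, (mem_spectrum_iff ha hab r).mpr hr, hr0, rfl⟩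
      exact (EReal.coe_lt_coe_iff.mp (hc.trans_le this)).le
    refine ⟨2 * c, by positivity, fun F hF => ?_⟩
    have hker : ∀ u, D.laplaceOp u = 0 → ⟪u, F⟫_ℂ = 0 := by
      intro u hu
      have hconst := hconn u (D.eq_of_laplaceOp_eq_zero hu)
      rcases isEmpty_or_nonempty V with hV | ⟨⟨x₀⟩⟩
      · have : u = 0 := vertexL2_ext fun x => hV.elim x
        rw [this, inner_zero_left]
      · have : u = u x₀ • D.one := vertexL2_ext fun x => by
          rw [(ae_vertexMeasure hpos).mp (Lp.coeFn_smul (u x₀) D.one) x, Pi.smul_apply,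
            one_apply hpos, smul_eq_mul, mul_one]
          exact hconst x x₀
        rw [this, inner_smul_left, hF, mul_zero]
    have := gap_of_spectrum D.isSelfAdjoint_laplaceOp hc0 hspec F hker
    rw [re_inner_laplaceOp] at this
    linarith
  · rintro ⟨c, hc, h⟩
    refine lt_of_lt_of_le (EReal.coe_pos.mpr (half_pos hc)) (le_sInf ?_)
    rintro t ⟨r, hr, hr0, rfl⟩
    rw [EReal.coe_le_coe_iff]
    by_contra! hlt
    refine (mem_spectrum_iff ha hab r).mp hr
      (isUnit_sub_of_gap D.isSelfAdjoint_laplaceOp (fun F => ?_) hr0 hlt)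
    obtain ⟨z, F₀, hF, hF₀⟩ := exists_add_smul_one F
    refine ⟨z • D.one, F₀, hF, by rw [map_smul, laplaceOp_one hpos, smul_zero],
      by rw [inner_smul_left, hF₀, mul_zero], ?_⟩
    rw [re_inner_laplaceOp]
    linarith [h F₀ hF₀]

/-- In the regular case, the infimum of the Rayleigh quotients is positive if and only if the
Poincaré inequality holds. -/
theorem rayleigh_pos_iff {k : ℝ} (hk : 0 < k) (hreg : D.IsRegular k) :
    0 < D.rayleigh ↔ D.Poincare := by
  have hpos : ∀ x, 0 < D.indeg x := fun x => by rw [hreg x]; exact hk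
  have hab : ∀ x, k ≤ D.indeg x ∧ D.indeg x ≤ k := fun x => ⟨(hreg x).ge, (hreg x).le⟩
  have hone : (D.one : V → ℂ) = 1 := funext (one_apply hpos)
  have hself : ∀ F : D.VertexL2, D.inner F F = ((‖F‖ ^ 2 / k : ℝ) : ℂ) := fun F => by
    rw [inner_eq hk hreg, inner_self_eq_norm_sq_to_K]; simp
  have hform : ∀ F : D.VertexL2,
      (D.inner (D.laplacian F) F).re = ‖D.pullSrc F - D.pullTgt F‖ ^ 2 / 2 / k := fun F => by
    have : D.laplacian F = D.laplaceOp F := (funext (laplaceOp_apply hpos F)).symm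
    rw [this, inner_eq hk hreg, ← re_inner_laplaceOp, Complex.div_ofReal_re, ← inner_conj_symm,
      Complex.conj_re]
  rw [← hasGap_iff_poincare hpos]
  constructor
  · intro h
    obtain ⟨c, hc0, hc⟩ := EReal.lt_iff_exists_real_btwn.mp h
    have hc0 : 0 < c := EReal.coe_pos.mp hc0
    refine ⟨2 * c, by positivity, fun F hF => ?_⟩
    rcases eq_or_ne F 0 with rfl | hF0
    · simp
    have hn : 0 < ‖F‖ := norm_pos_iff.mpr hF0
    set s : ℝ := √k / ‖F‖ with hs
    have hs2 : s ^ 2 = k / ‖F‖ ^ 2 := by rw [hs, div_pow, Real.sq_sqrt hk.le]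
    set F₁ : D.VertexL2 := (s : ℂ) • F with hF₁
    have hnorm : ‖F₁‖ ^ 2 = k := by
      rw [hF₁, norm_smul, mul_pow, Complex.norm_real, Real.norm_eq_abs, sq_abs, hs2]
      field_simp
    have hle : D.rayleigh ≤ (((D.inner (D.laplacian F₁) F₁).re : ℝ) : EReal) := by
      refine sInf_le ⟨F₁, (memL2_iff hk hab _).mpr (Lp.memLp F₁), ?_, ?_, rfl⟩
      · rw [← hone, inner_eq hk hreg, hF₁, inner_smul_right, hF]; simp
      · rw [hself, hnorm, div_self hk.ne', Complex.ofReal_one]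
    have h1 := (EReal.coe_lt_coe_iff.mp (hc.trans_le hle)).le
    have h2 : ‖D.pullSrc F₁ - D.pullTgt F₁‖ ^ 2 = s ^ 2 * ‖D.pullSrc F - D.pullTgt F‖ ^ 2 := by
      rw [hF₁, map_smul, map_smul, ← smul_sub, norm_smul, mul_pow, Complex.norm_real,
        Real.norm_eq_abs, sq_abs]
    rw [hform, h2, hs2] at h1
    have h3 : k / ‖F‖ ^ 2 * ‖D.pullSrc F - D.pullTgt F‖ ^ 2 / 2 / k =
        ‖D.pullSrc F - D.pullTgt F‖ ^ 2 / (2 * ‖F‖ ^ 2) := by field_simp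
    rw [h3, le_div_iff₀ (by positivity)] at h1
    linarith
  · rintro ⟨c, hc, h⟩
    refine lt_of_lt_of_le (EReal.coe_pos.mpr (half_pos hc)) (le_sInf ?_)
    rintro t ⟨f, hf, hf1, hff, rfl⟩
    have hf' := (memL2_iff hk hab _).mp hf
    have hcoe : (hf'.toLp f : V → ℂ) = f := funext (coe_toLp hpos hf')
    set F := hf'.toLp f
    rw [← hcoe] at hf1 hff ⊢
    rw [← hone, inner_eq hk hreg, div_eq_zero_iff] at hf1
    have hF := h F (hf1.resolve_right (by exact_mod_cast hk.ne'))
    rw [hself] at hff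
    have hff : ‖F‖ ^ 2 / k = 1 := by exact_mod_cast hff
    rw [div_eq_iff hk.ne', one_mul] at hff
    rw [hff] at hF
    rw [EReal.coe_le_coe_iff, hform, le_div_iff₀ hk]
    linarith

end Diagram

/-! ### Orbit maps on the coset space -/

section OrbitMap

variable {G : Type*} [Group G] (Γ : Subgroup G) {A : Type*} [MulAction G A]

/-- The map `Γg ↦ Γ(ga)` from `Γ\G` to `Γ\A`, for a point `a` of a `G`-set `A`. -/
def orbitMap (a : A) : RightCosets Γ → MulAction.orbitRel.Quotient Γ A :=
  Quotient.map (fun g => g • a) (by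
    intro g h hgh
    have h1 := QuotientGroup.rightRel_apply.mp hgh
    refine (MulAction.orbitRel Γ A).symm' ⟨⟨h * g⁻¹, h1⟩, ?_⟩
    change (h * g⁻¹) • g • a = h • a
    rw [smul_smul, inv_mul_cancel_right])

theorem RightCosets.exists_rep (x : RightCosets Γ) : ∃ g : G, Quotient.mk _ g = x :=
  Quotient.exists_rep x

theorem orbitMap_eq {x : RightCosets Γ} {g : G} (h : Quotient.mk _ g = x) (a : A) :
    orbitMap Γ a x = Quotient.mk _ (g • a) := by
  subst h
  rfl

theorem orbitMap_smul (h : G) (a : A) :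
    orbitMap Γ (h • a) = orbitMap Γ a ∘ RightCosets.translate Γ h := by
  funext x
  induction x using Quotient.inductionOn with
  | _ g => exact congrArg (Quotient.mk _) (smul_smul g h a)

theorem isOpen_preimage_orbitMap [TopologicalSpace G] {a : A} (ha : ∀ b, IsOpen {g : G | g • a = b})
    (s : Set (MulAction.orbitRel.Quotient Γ A)) : IsOpen (orbitMap Γ a ⁻¹' s) := by
  have h1 : IsOpen ((Quotient.mk (QuotientGroup.rightRel Γ)) ⁻¹' (orbitMap Γ a ⁻¹' s)) := by
    have : (Quotient.mk (QuotientGroup.rightRel Γ)) ⁻¹' (orbitMap Γ a ⁻¹' s) =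
        ⋃ b ∈ {b : A | (Quotient.mk _ b : MulAction.orbitRel.Quotient Γ A) ∈ s},
          {g : G | g • a = b} := by
      ext g
      simp only [Set.mem_preimage, Set.mem_iUnion, Set.mem_ofPred_eq, exists_prop,
        exists_eq_right']
      rfl
    rw [this]
    exact isOpen_biUnion fun b _ => ha b
  exact h1

end OrbitMap

/-! ### The topology of the automorphism group -/

section Topology

variable {V : Type*} {X : SimpleGraph V} {G : Subgroup (X ≃g X)}

theorem isOpen_setOf_apply_eq (v w : V) : IsOpen {g : X ≃g X | g v = w} := by
  let _ : TopologicalSpace V := ⊥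
  have : DiscreteTopology V := ⟨rfl⟩
  have h : Continuous fun g : X ≃g X => (g : V → V) := continuous_induced_dom
  exact (isOpen_discrete {w}).preimage ((continuous_apply v).comp h)

theorem isOpen_setOf_smul_vertex_eq (v w : V) : IsOpen {g : G | g • v = w} :=
  (isOpen_setOf_apply_eq v w).preimage continuous_subtype_val

theorem isOpen_setOf_smul_dart_eq (d d' : X.Dart) : IsOpen {g : G | g • d = d'} := by
  have : {g : G | g • d = d'} = {g : G | g • d.fst = d'.fst} ∩ {g : G | g • d.snd = d'.snd} := by
    ext g
    refine ⟨fun h => ?_, fun h => ?_⟩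
    · rw [← show g • d = d' from h]
      exact ⟨rfl, rfl⟩
    · exact SimpleGraph.Dart.ext _ _ (Prod.ext h.1 h.2)
  rw [this]
  exact (isOpen_setOf_smul_vertex_eq _ _).inter (isOpen_setOf_smul_vertex_eq _ _)

/-- Every open set that contains `g` also contains all automorphisms that agree with `g` on a suitable
finite set of vertices. -/
theorem exists_finset_of_isOpen_aut {O : Set (X ≃g X)} (hO : IsOpen O) {g : X ≃g X} (hg : g ∈ O) :
    ∃ F : Finset V, ∀ h : X ≃g X, (∀ v ∈ F, h v = g v) → h ∈ O := by
  let _ : TopologicalSpace V := ⊥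
  have : DiscreteTopology V := ⟨rfl⟩
  have hind : Topology.IsInducing (fun g : X ≃g X => (g : V → V)) := ⟨rfl⟩
  obtain ⟨O', hO', rfl⟩ := hind.isOpen_iff.mp hO
  obtain ⟨F, u, hu, hsub⟩ := isOpen_pi_iff.mp hO' _ hg
  refine ⟨F, fun h hh => hsub fun v hv => ?_⟩
  change h v ∈ u v
  rw [hh v hv]
  exact (hu v hv).2

theorem exists_finset_of_isOpen {O : Set G} (hO : IsOpen O) {g : G} (hg : g ∈ O) :
    ∃ F : Finset V, ∀ h : G, (∀ v ∈ F, h • v = g • v) → h ∈ O := by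
  obtain ⟨O', hO', rfl⟩ := isOpen_induced_iff.mp hO
  obtain ⟨F, hF⟩ := exists_finset_of_isOpen_aut hO' hg
  exact ⟨F, fun h hh => hF h hh⟩

end Topology

/-! ### The quotient diagram -/

section Quotient

variable {V : Type*} {X : SimpleGraph V} {G : Subgroup (X ≃g X)} (Γ : Subgroup G)

/-- The oriented edges with origin `v` that lie over a given oriented edge of `Γ\X` form an orbit of
the stabilizer of `v`, so that their number is `i(e)`. -/
theorem ncard_fiber (d : X.Dart) :
    {d' : X.Dart | d'.fst = d.fst ∧ (Quotient.mk _ d' : QuotE Γ) = Quotient.mk _ d}.ncard =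
      (MulAction.stabilizer Γ d).relIndex (MulAction.stabilizer Γ d.fst) := by
  have h1 : {d' : X.Dart | d'.fst = d.fst ∧ (Quotient.mk _ d' : QuotE Γ) = Quotient.mk _ d} =
      MulAction.orbit (MulAction.stabilizer Γ d.fst) d := by
    ext d'
    constructor
    · rintro ⟨hd, hq⟩
      obtain ⟨γ, hγ⟩ := Quotient.exact hq
      refine ⟨⟨γ, ?_⟩, hγ⟩
      have : γ • d.fst = d'.fst := congrArg (fun d : X.Dart => d.fst) hγ
      exact this.trans hd
    · rintro ⟨γ, rfl⟩
      exact ⟨γ.2, Quotient.sound ⟨γ.1, rfl⟩⟩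
  rw [h1, ← MulAction.index_stabilizer, Subgroup.relIndex]
  rfl

variable {Γ}

theorem src_orbitMap [X.LocallyFinite] (hX : X.Connected) (hΓ : DiscreteTopology Γ) (d : X.Dart) :
    (quotientDiagram Γ hX hΓ).src ∘ orbitMap Γ d = orbitMap Γ d.fst := by
  funext x
  induction x using Quotient.inductionOn with
  | _ g => rfl

theorem tgt_orbitMap [X.LocallyFinite] (hX : X.Connected) (hΓ : DiscreteTopology Γ) (d : X.Dart) :
    (quotientDiagram Γ hX hΓ).tgt ∘ orbitMap Γ d = orbitMap Γ d.snd := by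
  funext x
  induction x using Quotient.inductionOn with
  | _ g => rfl

theorem rev_orbitMap [X.LocallyFinite] (hX : X.Connected) (hΓ : DiscreteTopology Γ) (d : X.Dart) :
    (quotientDiagram Γ hX hΓ).rev ∘ orbitMap Γ d = orbitMap Γ d.symm := by
  funext x
  induction x using Quotient.inductionOn with
  | _ g => rfl

/-- A function on the vertices of `X` that is constant along edges is constant. -/
theorem eq_of_adj {α : Type*} (hX : X.Connected) {f : V → α} (hf : ∀ v w, X.Adj v w → f v = f w)
    (v w : V) : f v = f w := by
  obtain ⟨p⟩ := hX.preconnected v w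
  induction p with
  | nil => rfl
  | cons h _ ih => exact (hf _ _ h).trans ih

theorem countable_of_connected [X.LocallyFinite] (hX : X.Connected) : Countable V := by
  obtain ⟨x⟩ := hX.nonempty
  rw [← Set.countable_univ_iff]
  refine (Set.countable_iUnion fun n => (finite_walk_sphere X n x).countable).mono fun y _ => ?_
  obtain ⟨p⟩ := hX.preconnected x y
  exact Set.mem_iUnion.mpr ⟨p.length, p, rfl⟩

instance [Countable V] : Countable X.Dart :=
  (SimpleGraph.Dart.toProd_injective (G := X)).countable

variable (Γ) in
instance [Countable V] : Countable (QuotV Γ) := inferInstanceAs (Countable (Quotient _))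

variable (Γ) in
instance [Countable V] : Countable (QuotE Γ) := inferInstanceAs (Countable (Quotient _))

/-- The number of edges at `v` that `g` moves over a given oriented edge `e` of `Γ\X` is `i(e)`, if
the origin of `e` lies under `gv`. -/
theorem ncard_neighborSet [X.LocallyFinite] (hX : X.Connected) (hΓ : DiscreteTopology Γ) (g : G)
    {v : V} {d : X.Dart} (h : (Quotient.mk _ d.fst : QuotV Γ) = Quotient.mk _ (g • v)) :
    {w : X.neighborSet v |
      (Quotient.mk _ (g • X.dartOfNeighborSet v w) : QuotE Γ) = Quotient.mk _ d}.ncard =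
      (MulAction.stabilizer Γ d).relIndex (MulAction.stabilizer Γ d.fst) := by
  obtain ⟨γ, hγ⟩ := Quotient.exact h
  -- move `d` so that its origin is `gv`
  have hd : (γ⁻¹ • d).fst = g • v := by
    rw [fst_smul, inv_smul_eq_iff]; exact hγ.symm
  have hde : (Quotient.mk _ d : QuotE Γ) = Quotient.mk _ (γ⁻¹ • d) :=
    Quotient.sound ⟨γ, smul_inv_smul γ d⟩
  have hi := congrArg (quotientDiagram Γ hX hΓ).i hde
  rw [show (MulAction.stabilizer Γ d).relIndex (MulAction.stabilizer Γ d.fst) =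
    (MulAction.stabilizer Γ (γ⁻¹ • d)).relIndex (MulAction.stabilizer Γ (γ⁻¹ • d).fst) from
    Nat.cast_injective (R := ℝ) hi, ← ncard_fiber, hde]
  refine Set.ncard_congr (fun w _ => g • X.dartOfNeighborSet v w) ?_ ?_ ?_
  · exact fun w hw => ⟨hd.symm, hw⟩
  · exact fun w w' _ _ hw => X.dartOfNeighborSet_injective v (MulAction.injective g hw)
  · rintro d' ⟨h2, h3⟩
    have h4 : (g⁻¹ • d').fst = v := by
      have : (g⁻¹ • d').fst = g⁻¹ • d'.fst := rfl
      rw [this, h2, hd, inv_smul_smul]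
    have h5 : g • X.dartOfNeighborSet v ⟨(g⁻¹ • d').snd, by
        have := (g⁻¹ • d').adj
        rwa [h4] at this⟩ = d' := by
      rw [smul_eq_iff_eq_inv_smul]
      exact SimpleGraph.Dart.ext _ _ (Prod.ext h4.symm rfl)
    exact ⟨_, by rw [Set.mem_ofPred_eq, h5, h3], h5⟩

/-- Each vertex of `X` has as many edges as its image in `Γ\X`, counted with the weights `i`. -/
theorem indeg_mk [X.LocallyFinite] (hX : X.Connected) (hΓ : DiscreteTopology Γ) (v : V) :
    (quotientDiagram Γ hX hΓ).indeg (Quotient.mk _ v) = X.degree v := by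
  classical
  set D := quotientDiagram Γ hX hΓ with hD
  let φ : X.neighborSet v → QuotE Γ := fun w => Quotient.mk _ (X.dartOfNeighborSet v w)
  have hφ : ∀ w ∈ (Finset.univ : Finset (X.neighborSet v)), φ w ∈ D.star (Quotient.mk _ v) :=
    fun w _ => D.mem_star.mpr rfl
  have h1 := Finset.card_eq_sum_card_fiberwise hφ
  rw [Finset.card_univ, SimpleGraph.card_neighborSet_eq_degree] at h1
  rw [h1, Diagram.indeg, Nat.cast_sum]
  refine Finset.sum_congr rfl fun e he => ?_
  induction e using Quotient.inductionOn with
  | _ d =>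
    have h2 := ncard_neighborSet hX hΓ 1 (v := v) (d := d)
      (by rw [one_smul]; exact D.mem_star.mp he)
    simp only [one_smul] at h2
    change (((MulAction.stabilizer Γ d).relIndex (MulAction.stabilizer Γ d.fst) : ℕ) : ℝ) = _
    rw [← h2, Nat.cast_inj, ← Set.ncard_coe_finset]
    congr 1
    ext w
    simp [φ]

/-- The diagram `Γ\X` is connected. -/
theorem eq_of_src_eq_tgt [X.LocallyFinite] (hX : X.Connected) (hΓ : DiscreteTopology Γ)
    {f : QuotV Γ → ℂ} (hf : ∀ e, f ((quotientDiagram Γ hX hΓ).src e) =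
      f ((quotientDiagram Γ hX hΓ).tgt e)) (x y : QuotV Γ) : f x = f y := by
  induction x using Quotient.inductionOn with
  | _ v =>
    induction y using Quotient.inductionOn with
    | _ w =>
      exact eq_of_adj hX (f := fun v => f (Quotient.mk _ v))
        (fun v w h => hf (Quotient.mk _ ⟨(v, w), h⟩)) v w

end Quotient

/-! ### The image of the invariant measure on the quotient diagram -/

section Measure

variable {V : Type*} {X : SimpleGraph V} {G : Subgroup (X ≃g X)} {Γ : Subgroup G}

theorem exists_smul_dart_eq (hG : LocallyInftyTransitive G) {d d' : X.Dart} (h : d.fst = d'.fst) :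
    ∃ g : G, g • d = d' := by
  obtain ⟨g, hg, h1, h2⟩ := hG d.fst 1 le_rfl d.snd d'.snd
    (SimpleGraph.dist_eq_one_iff_adj.mpr d.adj)
    (SimpleGraph.dist_eq_one_iff_adj.mpr (by rw [h]; exact d'.adj))
  exact ⟨⟨g, hg⟩, SimpleGraph.Dart.ext _ _ (Prod.ext (h1.trans h) h2)⟩

theorem isOpen_preimage_orbitMap_vertex (v : V) (s : Set (QuotV Γ)) :
    IsOpen (orbitMap Γ v ⁻¹' s) :=
  isOpen_preimage_orbitMap Γ (isOpen_setOf_smul_vertex_eq v) s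

theorem isOpen_preimage_orbitMap_dart (d : X.Dart) (s : Set (QuotE Γ)) :
    IsOpen (orbitMap Γ d ⁻¹' s) :=
  isOpen_preimage_orbitMap Γ (isOpen_setOf_smul_dart_eq d) s

theorem measurable_orbitMap_vertex [MeasurableSpace (QuotV Γ)] (v : V) :
    Measurable (orbitMap Γ v) := fun s _ => (isOpen_preimage_orbitMap_vertex v s).measurableSet

theorem measurable_orbitMap_dart [MeasurableSpace (QuotE Γ)] (d : X.Dart) :
    Measurable (orbitMap Γ d) := fun s _ => (isOpen_preimage_orbitMap_dart d s).measurableSet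

variable {μ : Measure (RightCosets Γ)}

theorem measure_orbitMap_smul_dart (hμ : IsFiniteInvariantMeasure Γ μ) (g : G) (d : X.Dart)
    (s : Set (QuotE Γ)) : μ (orbitMap Γ (g • d) ⁻¹' s) = μ (orbitMap Γ d ⁻¹' s) := by
  rw [orbitMap_smul, Set.preimage_comp]
  exact (hμ.invariant g).measure_preimage
    (isOpen_preimage_orbitMap_dart d s).measurableSet.nullMeasurableSet

/-- Since the stabilizer of the origin `x` of `d₀` is transitive on the edges at `x`, the cosets
`Γg` for which `gd₀` lies over the oriented edge `e` make up the fraction `i(e) / deg x` of those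
for which `gx` lies over the origin of `e`. -/
theorem degree_mul_measure [X.LocallyFinite] (hX : X.Connected) (hΓ : DiscreteTopology Γ)
    (hG : LocallyInftyTransitive G) (hμ : IsFiniteInvariantMeasure Γ μ) (d₀ d : X.Dart) :
    (X.degree d₀.fst : ℝ≥0∞) * μ (orbitMap Γ d₀ ⁻¹' {Quotient.mk _ d}) =
      ((MulAction.stabilizer Γ d).relIndex (MulAction.stabilizer Γ d.fst) : ℕ) *
        μ (orbitMap Γ d₀.fst ⁻¹' {Quotient.mk _ d.fst}) := by
  classical
  set B : X.neighborSet d₀.fst → Set (RightCosets Γ) := fun w =>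
    orbitMap Γ (X.dartOfNeighborSet d₀.fst w) ⁻¹' {Quotient.mk _ d} with hB
  have hBm : ∀ w, MeasurableSet (B w) := fun w => (isOpen_preimage_orbitMap_dart _ _).measurableSet
  have h1 : ∀ w, μ (B w) = μ (orbitMap Γ d₀ ⁻¹' {Quotient.mk _ d}) := by
    intro w
    obtain ⟨g, hg⟩ := exists_smul_dart_eq hG (d := d₀) (d' := X.dartOfNeighborSet d₀.fst w) rfl
    simp only [hB]
    rw [← hg]
    exact measure_orbitMap_smul_dart hμ g d₀ _
  have h2 : ∑ w, μ (B w) =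
      (X.degree d₀.fst : ℝ≥0∞) * μ (orbitMap Γ d₀ ⁻¹' {Quotient.mk _ d}) := by
    simp only [h1, Finset.sum_const, Finset.card_univ, SimpleGraph.card_neighborSet_eq_degree,
      nsmul_eq_mul]
  have h3 : ∀ x, ∑ w, (B w).indicator 1 x =
      (((MulAction.stabilizer Γ d).relIndex (MulAction.stabilizer Γ d.fst) : ℕ) : ℝ≥0∞) *
        (orbitMap Γ d₀.fst ⁻¹' {Quotient.mk _ d.fst}).indicator 1 x := by
    intro x
    obtain ⟨g, hgx⟩ := RightCosets.exists_rep Γ x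
    have hB' : ∀ w, x ∈ B w ↔
        (Quotient.mk _ (g • X.dartOfNeighborSet d₀.fst w) : QuotE Γ) = Quotient.mk _ d := fun w => by
      rw [← orbitMap_eq Γ hgx]; rfl
    have hA : x ∈ orbitMap Γ d₀.fst ⁻¹' {Quotient.mk _ d.fst} ↔
        (Quotient.mk _ d.fst : QuotV Γ) = Quotient.mk _ (g • d₀.fst) := by
      rw [← orbitMap_eq Γ hgx, eq_comm]; rfl
    by_cases hg : (Quotient.mk _ d.fst : QuotV Γ) = Quotient.mk _ (g • d₀.fst)
    · rw [Set.indicator_of_mem (hA.mpr hg), ← ncard_neighborSet hX hΓ g hg, Pi.one_apply, mul_one]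
      simp only [Set.indicator_apply, Pi.one_apply, Finset.sum_boole, hB']
      rw [← Set.ncard_coe_finset]
      simp
    · rw [Set.indicator_of_notMem (fun h => hg (hA.mp h)), mul_zero]
      refine Finset.sum_eq_zero fun w _ => Set.indicator_of_notMem (fun h => hg ?_) _
      exact (congrArg (quotientDiagram Γ hX hΓ).src ((hB' w).mp h)).symm
  rw [← h2]
  simp only [← fun w => lintegral_indicator_one (μ := μ) (hBm w)]
  rw [← lintegral_finsetSum _ fun w _ => measurable_one.indicator (hBm w)]
  simp only [h3]
  rw [lintegral_const_mul _ (measurable_one.indicator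
    (isOpen_preimage_orbitMap_vertex _ _).measurableSet), lintegral_indicator_one
    (isOpen_preimage_orbitMap_vertex _ _).measurableSet]

variable [MeasurableSpace (QuotE Γ)] [DiscreteMeasurableSpace (QuotE Γ)]

/-- Up to a positive factor, the measure `μ(e)` on the oriented edges of `Γ\X` is the sum of the
images of the invariant measure under `Γg ↦ Γgd₀` and under `Γg ↦ Γgd₀'`, where `d₀'` is the reverse
of `d₀`. -/
theorem exists_map_add_map_eq [X.LocallyFinite] (hX : X.Connected) (hΓ : DiscreteTopology Γ)
    (hG : LocallyInftyTransitive G) (hμ : IsFiniteInvariantMeasure Γ μ) (d₀ : X.Dart) :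
    ∃ c : ℝ≥0, c ≠ 0 ∧ μ.map (orbitMap Γ d₀) + μ.map (orbitMap Γ d₀.symm) =
      c • (quotientDiagram Γ hX hΓ).edgeMeasure := by
  have hfin := hμ.finite
  have hV : Countable V := countable_of_connected hX
  set η : Measure (QuotE Γ) := μ.map (orbitMap Γ d₀) + μ.map (orbitMap Γ d₀.symm) with hη
  have hη_apply : ∀ e, η {e} = μ (orbitMap Γ d₀ ⁻¹' {e}) + μ (orbitMap Γ d₀.symm ⁻¹' {e}) := by
    intro e
    rw [hη, Measure.add_apply, Measure.map_apply (measurable_orbitMap_dart _) (.of_discrete),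
      Measure.map_apply (measurable_orbitMap_dart _) (.of_discrete)]
  let T : V → ℝ≥0∞ := fun v => Nat.card (MulAction.stabilizer Γ v) *
    (μ (orbitMap Γ d₀.fst ⁻¹' {Quotient.mk _ v}) / X.degree d₀.fst +
      μ (orbitMap Γ d₀.snd ⁻¹' {Quotient.mk _ v}) / X.degree d₀.snd)
  have hdeg : ∀ d : X.Dart, (X.degree d.fst : ℝ≥0∞) ≠ 0 := fun d => by
    rw [Nat.cast_ne_zero, ← Nat.pos_iff_ne_zero, SimpleGraph.degree_pos_iff_exists_adj]
    exact ⟨d.snd, d.adj⟩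
  have hone : ∀ d' d : X.Dart,
      (Nat.card (MulAction.stabilizer Γ d) : ℝ≥0∞) * μ (orbitMap Γ d' ⁻¹' {Quotient.mk _ d}) =
      Nat.card (MulAction.stabilizer Γ d.fst) *
        (μ (orbitMap Γ d'.fst ⁻¹' {Quotient.mk _ d.fst}) / X.degree d'.fst) := by
    intro d' d
    rw [← relIndex_mul_card Γ d, Nat.cast_mul, mul_comm (Nat.cast _) (Nat.cast _), mul_assoc,
      ← mul_div_assoc, ← degree_mul_measure hX hΓ hG hμ d' d, mul_comm (X.degree _ : ℝ≥0∞),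
      ENNReal.mul_div_cancel_right (hdeg d') (ENNReal.natCast_ne_top _)]
  have hT : ∀ d : X.Dart,
      (Nat.card (MulAction.stabilizer Γ d) : ℝ≥0∞) * η {Quotient.mk _ d} = T d.fst := by
    intro d
    rw [hη_apply, mul_add, hone, hone, ← mul_add]
    rfl
  have hsymm : ∀ d : X.Dart, η {Quotient.mk _ d.symm} = η {Quotient.mk _ d} := by
    have : ∀ d' d : X.Dart, orbitMap Γ d'.symm ⁻¹' {Quotient.mk _ d.symm} =
        orbitMap Γ d' ⁻¹' {Quotient.mk _ d} := by
      intro d' d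
      rw [← rev_orbitMap hX hΓ]
      ext x
      have hinj : Function.Injective (quotientDiagram Γ hX hΓ).rev :=
        (show Function.Involutive _ from (quotientDiagram Γ hX hΓ).rev_rev).injective
      exact hinj.eq_iff (b := Quotient.mk _ d)
    intro d
    rw [hη_apply, hη_apply, this, ← d₀.symm_symm, this, d₀.symm_symm, add_comm]
  -- `T` depends on the origin of an oriented edge only, and is invariant under edge reversal
  have hconst : ∀ v w, T v = T w := eq_of_adj hX fun v w h => by
    have h1 := hT ⟨(v, w), h⟩
    have h2 := hT (SimpleGraph.Dart.symm ⟨(v, w), h⟩)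
    rw [hsymm, stabilizer_symm, h1] at h2
    exact h2
  have hcard : ∀ d : X.Dart, Nat.card (MulAction.stabilizer Γ d) ≠ 0 := fun d => by
    have := finite_stabilizer Γ hX hΓ d.fst
    have : Finite (MulAction.stabilizer Γ d) :=
      Finite.of_injective _ (Subgroup.inclusion_injective (stabilizer_dart_le Γ d))
    exact Nat.card_pos.ne'
  have hηfin : ∀ e, η {e} ≠ ∞ := fun e => by
    rw [hη_apply]
    exact ENNReal.add_ne_top.mpr ⟨measure_ne_top _ _, measure_ne_top _ _⟩
  have hTtop : T d₀.fst ≠ ∞ := by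
    rw [← hT]
    exact ENNReal.mul_ne_top (ENNReal.natCast_ne_top _) (hηfin _)
  have hηeq : η = (T d₀.fst).toNNReal • (quotientDiagram Γ hX hΓ).edgeMeasure := by
    refine Measure.ext_of_singleton fun e => ?_
    induction e using Quotient.inductionOn with
    | _ d =>
      have h1 : (quotientDiagram Γ hX hΓ).μE (Quotient.mk _ d) =
        1 / (Nat.card (MulAction.stabilizer Γ d) : ℝ) := rfl
      rw [Measure.smul_apply, Diagram.edgeMeasure_singleton, h1, one_div,
        ENNReal.ofReal_inv_of_pos (Nat.cast_pos.mpr (Nat.pos_of_ne_zero (hcard d))),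
        ENNReal.ofReal_natCast, ENNReal.smul_def, ENNReal.coe_toNNReal hTtop,
        hconst d₀.fst d.fst, ← hT d, smul_eq_mul, ← div_eq_mul_inv, mul_comm,
        ENNReal.mul_div_cancel_right (Nat.cast_ne_zero.mpr (hcard d)) (ENNReal.natCast_ne_top _)]
  refine ⟨_, fun h0 => ?_, hηeq⟩
  rw [h0, zero_smul] at hηeq
  have h1 : η Set.univ = 0 := by rw [hηeq]; rfl
  rw [hη, Measure.add_apply, Measure.map_apply (measurable_orbitMap_dart _) .univ] at h1
  exact hμ.ne_zero (Measure.measure_univ_eq_zero.mp (add_eq_zero.mp h1).1)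

end Measure

/-! ### A spectral gap implies the Poincaré inequality -/

theorem eLpNorm_two_add_measure_le {α : Type*} [MeasurableSpace α] (μ ν : Measure α) (g : α → ℂ) :
    eLpNorm g 2 (μ + ν) ≤ eLpNorm g 2 μ + eLpNorm g 2 ν := by
  have h : ∀ m : Measure α, eLpNorm g 2 m ^ (2 : ℝ) = ∫⁻ x, ‖g x‖ₑ ^ (2 : ℝ) ∂m := fun m =>
    eLpNorm_nnreal_pow_eq_lintegral (p := 2) two_ne_zero
  rw [← ENNReal.rpow_le_rpow_iff (z := 2) two_pos, h, lintegral_add_measure, ← h, ← h]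
  exact ENNReal.add_rpow_le_rpow_add _ _ one_le_two

section Gap

variable {V : Type*} {X : SimpleGraph V} {G : Subgroup (X ≃g X)} {Γ : Subgroup G}
  {μ : Measure (RightCosets Γ)}

/-- `G` is transitive on the edges of `X`, up to reversal. -/
theorem exists_smul_dart_eq_or (hX : X.Connected) (hG : LocallyInftyTransitive G) (d₀ d : X.Dart) :
    ∃ g : G, g • d₀ = d ∨ g • d₀.symm = d := by
  let P : V → Prop := fun v => ∀ d : X.Dart, d.fst = v → ∃ g : G, g • d₀ = d ∨ g • d₀.symm = d
  have step : ∀ v w, X.Adj v w → P v → P w := by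
    intro v w h hv d hd
    obtain ⟨g, hg⟩ := hv ⟨(v, w), h⟩ rfl
    obtain ⟨k, hk⟩ := exists_smul_dart_eq hG (d := SimpleGraph.Dart.symm ⟨(v, w), h⟩) (d' := d)
      hd.symm
    refine ⟨k * g, hg.symm.imp (fun hg => ?_) (fun hg => ?_)⟩
    · rw [mul_smul, ← hk, ← hg]; rfl
    · rw [mul_smul, ← hk, ← hg]; rfl
  have h₀ : P d₀.fst := fun d hd => by
    obtain ⟨g, hg⟩ := exists_smul_dart_eq hG hd.symm
    exact ⟨g, Or.inl hg⟩
  have := eq_of_adj hX (f := P) (fun v w h => propext ⟨step v w h, step w v h.symm⟩) d₀.fst d.fst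
  exact (this.mp h₀) d rfl

section Comparison

variable [X.LocallyFinite] [MeasurableSpace (QuotE Γ)] [DiscreteMeasurableSpace (QuotE Γ)]
  [MeasurableSpace (QuotV Γ)] [DiscreteMeasurableSpace (QuotV Γ)]

/-- Up to a factor, norms of functions on the oriented edges and on the vertices of `Γ\X` can be
computed on `Γ\G`. -/
theorem exists_norm_comparison (hX : X.Connected) (hΓ : DiscreteTopology Γ)
    (hG : LocallyInftyTransitive G) (hμ : IsFiniteInvariantMeasure Γ μ) (d₀ : X.Dart) :
    ∃ K : ℝ≥0, K ≠ 0 ∧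
      (∀ g : QuotE Γ → ℂ,
        eLpNorm (g ∘ orbitMap Γ d₀) 2 μ ≤ K * eLpNorm g 2 (quotientDiagram Γ hX hΓ).edgeMeasure ∧
        K * eLpNorm g 2 (quotientDiagram Γ hX hΓ).edgeMeasure ≤
          eLpNorm (g ∘ orbitMap Γ d₀) 2 μ + eLpNorm (g ∘ orbitMap Γ d₀.symm) 2 μ) ∧
      ∀ f : QuotV Γ → ℂ,
        eLpNorm (f ∘ orbitMap Γ d₀.fst) 2 μ ≤
          K * eLpNorm f 2 (quotientDiagram Γ hX hΓ).vertexMeasure ∧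
        K * eLpNorm f 2 (quotientDiagram Γ hX hΓ).vertexMeasure ≤
          eLpNorm (f ∘ orbitMap Γ d₀.fst) 2 μ + eLpNorm (f ∘ orbitMap Γ d₀.snd) 2 μ := by
  have hV : Countable V := countable_of_connected hX
  obtain ⟨c, hc, h⟩ := exists_map_add_map_eq hX hΓ hG hμ d₀
  have hedge : ∀ g : QuotE Γ → ℂ,
      eLpNorm (g ∘ orbitMap Γ d₀) 2 μ ≤
        (c ^ (1 / 2 : ℝ) : ℝ≥0) * eLpNorm g 2 (quotientDiagram Γ hX hΓ).edgeMeasure ∧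
      (c ^ (1 / 2 : ℝ) : ℝ≥0) * eLpNorm g 2 (quotientDiagram Γ hX hΓ).edgeMeasure ≤
        eLpNorm (g ∘ orbitMap Γ d₀) 2 μ + eLpNorm (g ∘ orbitMap Γ d₀.symm) 2 μ := by
    intro g
    have h1 : ((c ^ (1 / 2 : ℝ) : ℝ≥0) : ℝ≥0∞) *
        eLpNorm g 2 (quotientDiagram Γ hX hΓ).edgeMeasure =
        eLpNorm g 2 (μ.map (orbitMap Γ d₀) + μ.map (orbitMap Γ d₀.symm)) := by
      rw [h, eLpNorm_smul_measure_of_ne_top' ENNReal.ofNat_ne_top]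
      simp [ENNReal.smul_def]
    have h2 : ∀ d : X.Dart, eLpNorm (g ∘ orbitMap Γ d) 2 μ = eLpNorm g 2 (μ.map (orbitMap Γ d)) :=
      fun d => (eLpNorm_map_measure (by fun_prop) (measurable_orbitMap_dart d).aemeasurable).symm
    rw [h1, h2, h2]
    exact ⟨eLpNorm_mono_measure _ (Measure.le_add_right le_rfl), eLpNorm_two_add_measure_le _ _ _⟩
  refine ⟨c ^ (1 / 2 : ℝ), by simp [hc], hedge, fun f => ?_⟩
  have h1 := hedge (f ∘ (quotientDiagram Γ hX hΓ).src)
  rwa [eLpNorm_comp_measurePreserving (by fun_prop)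
    (quotientDiagram Γ hX hΓ).measurePreserving_src, Function.comp_assoc, Function.comp_assoc,
    src_orbitMap, src_orbitMap] at h1

end Comparison

section Path

variable [MeasurableSpace (QuotV Γ)] [DiscreteMeasurableSpace (QuotV Γ)]

theorem aestronglyMeasurable_comp_orbitMap (f : QuotV Γ → ℂ) (v : V) :
    AEStronglyMeasurable (fun x => f (orbitMap Γ v x)) μ :=
  ((Measurable.of_discrete (f := f)).comp
    (measurable_orbitMap_vertex v)).aestronglyMeasurable

/-- Along a path from `v` to `w`, the distance of `f ∘ p_v` and `f ∘ p_w` grows with each step by the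
same amount: each edge is a translate of `d₀` or of its reverse, and translations preserve `μ`. -/
theorem eLpNorm_sub_orbitMap_le (hX : X.Connected) (hG : LocallyInftyTransitive G)
    (hμ : IsFiniteInvariantMeasure Γ μ) (d₀ : X.Dart) (f : QuotV Γ → ℂ) {v w : V}
    (p : X.Walk v w) :
    eLpNorm (fun x => f (orbitMap Γ v x) - f (orbitMap Γ w x)) 2 μ ≤
      p.length * eLpNorm (fun x => f (orbitMap Γ d₀.fst x) - f (orbitMap Γ d₀.snd x)) 2 μ := by
  have hadj : ∀ d : X.Dart, eLpNorm (fun x => f (orbitMap Γ d.fst x) - f (orbitMap Γ d.snd x)) 2 μ =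
      eLpNorm (fun x => f (orbitMap Γ d₀.fst x) - f (orbitMap Γ d₀.snd x)) 2 μ := by
    intro d
    have hsmul : ∀ (g : G) (v w : V),
        eLpNorm (fun x => f (orbitMap Γ (g • v) x) - f (orbitMap Γ (g • w) x)) 2 μ =
        eLpNorm (fun x => f (orbitMap Γ v x) - f (orbitMap Γ w x)) 2 μ := by
      intro g v w
      have := eLpNorm_comp_measurePreserving (p := 2)
        ((aestronglyMeasurable_comp_orbitMap f v).sub (aestronglyMeasurable_comp_orbitMap f w))
        (hμ.invariant g)
      rw [orbitMap_smul, orbitMap_smul]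
      exact this
    obtain ⟨g, hg | hg⟩ := exists_smul_dart_eq_or hX hG d₀ d
    · rw [show d.fst = g • d₀.fst by rw [← hg]; rfl, show d.snd = g • d₀.snd by rw [← hg]; rfl]
      exact hsmul g d₀.fst d₀.snd
    · rw [show d.fst = g • d₀.snd by rw [← hg]; rfl, show d.snd = g • d₀.fst by rw [← hg]; rfl,
        hsmul]
      exact eLpNorm_sub_comm (fun x => f (orbitMap Γ d₀.snd x))
        (fun x => f (orbitMap Γ d₀.fst x)) 2 μ
  induction p with
  | nil => simp
  | @cons u v w h p ih =>
    have h1 := eLpNorm_add_le (p := 2) (μ := μ)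
      ((aestronglyMeasurable_comp_orbitMap f u).sub (aestronglyMeasurable_comp_orbitMap f v))
      ((aestronglyMeasurable_comp_orbitMap f v).sub (aestronglyMeasurable_comp_orbitMap f w))
      one_le_two
    have h2 := hadj ⟨(u, v), h⟩
    simp only [sub_add_sub_cancel] at h1
    rw [SimpleGraph.Walk.length_cons, Nat.cast_add, Nat.cast_one, add_mul, one_mul, add_comm]
    exact h1.trans (add_le_add h2.le ih)

end Path

theorem exists_forall_dist_le (v : V) {Q : Set G} (hQ : IsCompact Q) :
    ∃ N : ℕ, ∀ g ∈ Q, X.dist v (g • v) ≤ N := by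
  let _ : TopologicalSpace V := ⊥
  have : DiscreteTopology V := ⟨rfl⟩
  have hcont : Continuous fun g : G => g • v := by
    refine continuous_discrete_rng.mpr fun w => ?_
    exact isOpen_setOf_smul_vertex_eq v w
  obtain ⟨N, hN⟩ := ((hQ.image hcont).finite_of_discrete.image (X.dist v)).bddAbove
  exact ⟨N, fun g hg => hN (Set.mem_image_of_mem _ (Set.mem_image_of_mem _ hg))⟩

/-- The spectral gap in a form that is homogeneous in the vector. -/
theorem HasSpectralGap.exists_le {hμ : IsFiniteInvariantMeasure Γ μ} (h : HasSpectralGap hμ) :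
    ∃ Q : Set G, IsCompact Q ∧ ∃ ε : ℝ, 0 < ε ∧ ∀ ξ : Lp ℂ 2 μ, ∫ x, ξ x ∂μ = 0 → ξ ≠ 0 →
      ∃ g ∈ Q, ε * ‖ξ‖ ≤ ‖rho hμ g ξ - ξ‖ := by
  simp only [HasSpectralGap, HasAlmostInvariantVectors, not_forall, not_exists, not_and] at h
  obtain ⟨Q, hQ, ε, hε, h⟩ := h
  refine ⟨Q, hQ, ε, hε, fun ξ hξ hξ0 => ?_⟩
  have hn : 0 < ‖ξ‖ := norm_pos_iff.mpr hξ0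
  let ξ' : (L20 hμ).toSubmodule := ⟨ξ, hξ⟩
  have hunit : ‖((‖ξ‖⁻¹ : ℝ) : ℂ) • ξ'‖ = 1 := by
    rw [norm_smul, Complex.norm_real, norm_inv, norm_norm]
    exact inv_mul_cancel₀ hn.ne'
  obtain ⟨g, hg, hle⟩ := h _ hunit
  refine ⟨g, hg, ?_⟩
  rw [not_lt, map_smul, ← smul_sub, norm_smul, Complex.norm_real, norm_inv, norm_norm,
    inv_mul_eq_div, le_div_iff₀ hn] at hle
  exact hle

variable [X.LocallyFinite] [MeasurableSpace (QuotE Γ)] [DiscreteMeasurableSpace (QuotE Γ)]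
  [MeasurableSpace (QuotV Γ)] [DiscreteMeasurableSpace (QuotV Γ)]

/-- The vector `f ∘ p₀ - a` of mean zero, where `p₀` is the orbit map of the origin of `d₀`, is moved by
each `g` in a compact set at most by a multiple of the norm of the gradient of `f`, so the spectral
gap bounds its norm. -/
theorem poincare_of_hasSpectralGap (hX : X.Connected) (hΓ : DiscreteTopology Γ)
    (hG : LocallyInftyTransitive G) (hμ : IsFiniteInvariantMeasure Γ μ) (d₀ : X.Dart)
    (hgap : HasSpectralGap hμ) : (quotientDiagram Γ hX hΓ).Poincare := by
  have hfin := hμ.finite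
  have hV : Countable V := countable_of_connected hX
  set D := quotientDiagram Γ hX hΓ with hD
  obtain ⟨K, hK, hcomp, hvert⟩ := exists_norm_comparison hX hΓ hG hμ d₀
  obtain ⟨Q, hQ, ε, hε, hgap⟩ := hgap.exists_le
  obtain ⟨N, hN⟩ := exists_forall_dist_le d₀.fst hQ
  refine ⟨2 * (N / ε.toNNReal) + 1, fun f hf => ?_⟩
  set p₀ := orbitMap Γ d₀.fst with hp₀
  set p₁ := orbitMap Γ d₀.snd with hp₁
  set δ := eLpNorm (fun x => f (p₀ x) - f (p₁ x)) 2 μ with hδ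
  have hδle : δ ≤ K * eLpNorm (fun e => f (D.src e) - f (D.tgt e)) 2 D.edgeMeasure := by
    refine le_trans (le_of_eq ?_) (hcomp fun e => f (D.src e) - f (D.tgt e)).1
    rw [hδ, hp₀, hp₁, ← src_orbitMap hX hΓ, ← tgt_orbitMap hX hΓ]
    rfl
  have hmem : MemLp (fun x => f (p₀ x)) 2 μ :=
    ⟨aestronglyMeasurable_comp_orbitMap f _,
      (hvert f).1.trans_lt (ENNReal.mul_lt_top ENNReal.coe_lt_top hf.2)⟩
  -- subtract the mean value
  set a : ℂ := ⨍ x, f (p₀ x) ∂μ with ha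
  have hmem' : MemLp (fun x => f (p₀ x) - a) 2 μ := hmem.sub (memLp_const a)
  set ξ := hmem'.toLp with hξ
  have hξint : ∫ x, ξ x ∂μ = 0 := by
    rw [integral_congr_ae hmem'.coeFn_toLp]
    exact integral_sub_average μ _
  have hξnorm : eLpNorm (fun x => f (p₀ x) - a) 2 μ = ‖ξ‖ₑ := (Lp.enorm_toLp hmem').symm
  have hbound : ‖ξ‖ₑ ≤ ((N / ε.toNNReal : ℝ≥0) : ℝ≥0∞) * δ := by
    rcases eq_or_ne ξ 0 with h0 | h0
    · rw [h0, enorm_zero]; exact zero_le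
    obtain ⟨g, hg, hle⟩ := hgap ξ hξint h0
    have h1 : ‖rho hμ g ξ - ξ‖ₑ ≤ N * δ := by
      obtain ⟨p, hp⟩ := (hX.preconnected d₀.fst (g • d₀.fst)).exists_walk_length_eq_dist
      have h2 := eLpNorm_sub_orbitMap_le hX hG hμ d₀ f p
      have h3 : ‖rho hμ g ξ - ξ‖ₑ =
          eLpNorm (fun x => f (orbitMap Γ d₀.fst x) - f (orbitMap Γ (g • d₀.fst) x)) 2 μ := by
        have hcomm := eLpNorm_sub_comm (fun x => f (orbitMap Γ d₀.fst x))
          (fun x => f (orbitMap Γ (g • d₀.fst) x)) 2 μ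
        refine Eq.trans ?_ hcomm.symm
        rw [Lp.enorm_def]
        refine eLpNorm_congr_ae ?_
        have h4 : rho hμ g ξ =ᵐ[μ] ξ ∘ RightCosets.translate Γ g :=
          Lp.coeFn_compMeasurePreserving ξ (hμ.invariant g)
        have h5 := (hμ.invariant g).quasiMeasurePreserving.ae_eq_comp hmem'.coeFn_toLp
        filter_upwards [h4, h5, hmem'.coeFn_toLp, Lp.coeFn_sub (rho hμ g ξ) ξ]
          with x h4 h5 h6 h7
        rw [h7, Pi.sub_apply, h4, h5, h6, Pi.sub_apply, orbitMap_smul]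
        simp [p₀]
      rw [h3]
      refine h2.trans ?_
      gcongr
      rw [hp]
      exact hN g hg
    have h2 : ENNReal.ofReal ε * ‖ξ‖ₑ ≤ N * δ := by
      refine le_trans ?_ h1
      rw [← ofReal_norm, ← ofReal_norm, ← ENNReal.ofReal_mul hε.le]
      exact ENNReal.ofReal_le_ofReal hle
    have hε' : ε.toNNReal ≠ 0 := by simpa using hε
    rw [ENNReal.coe_div hε', ENNReal.coe_natCast, ← ENNReal.mul_div_right_comm,
      ENNReal.le_div_iff_mul_le (Or.inl (by exact_mod_cast hε')) (Or.inl ENNReal.coe_ne_top),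
      mul_comm]
    exact h2
  refine ⟨a, ?_⟩
  have h1 : eLpNorm (fun x => f (p₁ x) - a) 2 μ ≤ ‖ξ‖ₑ + δ := by
    have h2 := eLpNorm_sub_le (p := 2) (μ := μ) hmem'.1
      ((aestronglyMeasurable_comp_orbitMap f d₀.fst).sub
        (aestronglyMeasurable_comp_orbitMap f d₀.snd)) one_le_two
    rw [hξnorm] at h2
    refine le_trans (le_of_eq ?_) h2
    congr 1
    funext x
    simp [p₀, p₁]
  have h2 := (hvert fun x => f x - a).2
  simp only [Function.comp_def] at h2
  rw [hξnorm] at h2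
  have h3 : K * eLpNorm (fun x => f x - a) 2 D.vertexMeasure ≤
      K * (((2 * (N / ε.toNNReal) + 1 : ℝ≥0) : ℝ≥0∞) *
        eLpNorm (fun e => f (D.src e) - f (D.tgt e)) 2 D.edgeMeasure) := by
    calc _ ≤ ‖ξ‖ₑ + (‖ξ‖ₑ + δ) := h2.trans (by gcongr)
      _ = 2 * ‖ξ‖ₑ + δ := by ring
      _ ≤ 2 * (((N / ε.toNNReal : ℝ≥0) : ℝ≥0∞) * δ) + δ := by gcongr
      _ = ((2 * (N / ε.toNNReal) + 1 : ℝ≥0) : ℝ≥0∞) * δ := by push_cast; ring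
      _ ≤ _ := by
        rw [mul_left_comm]
        gcongr
  rwa [ENNReal.mul_le_mul_iff_right (by exact_mod_cast hK) ENNReal.coe_ne_top] at h3

end Gap

/-! ### Compactness of vertex stabilizers -/

section Compact

variable {V : Type*} {X : SimpleGraph V}

theorem finite_orbit_stabilizer [X.LocallyFinite] (hX : X.Connected) (v w : V) :
    {y | ∃ g : X ≃g X, g v = v ∧ g w = y}.Finite := by
  obtain ⟨p⟩ := hX.preconnected v w
  refine (finite_walk_sphere X p.length v).subset ?_
  rintro y ⟨g, hv, rfl⟩
  exact ⟨(p.map (g : X →g X)).copy hv rfl, by simp⟩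

/-- An ultrafilter on the stabilizer of a vertex in `Aut(X)` converges: on each vertex `w`, both `g`
and its inverse take almost always the same value, and these values define an automorphism. -/
theorem isCompact_stabilizer_aut [X.LocallyFinite] (hX : X.Connected) (v : V) :
    IsCompact {g : X ≃g X | g v = v} := by
  rw [isCompact_iff_ultrafilter_le_nhds]
  intro U hU
  have hK : {g : X ≃g X | g v = v} ∈ U := Filter.le_principal_iff.mp hU
  have hφ : ∀ w, ∃ y, ∀ᶠ g : X ≃g X in U, g w = y := by
    intro w
    have h1 : (⋃ y ∈ {y | ∃ g : X ≃g X, g v = v ∧ g w = y}, {g : X ≃g X | g w = y}) ∈ U := by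
      filter_upwards [hK] with g hg
      exact Set.mem_biUnion ⟨g, hg, rfl⟩ rfl
    obtain ⟨y, _, hy⟩ := (Ultrafilter.finite_biUnion_mem_iff (finite_orbit_stabilizer hX v w)).mp h1
    exact ⟨y, hy⟩
  have hψ : ∀ w, ∃ y, ∀ᶠ g : X ≃g X in U, g.symm w = y := by
    intro w
    have h1 : (⋃ y ∈ {y | ∃ g : X ≃g X, g v = v ∧ g w = y}, {g : X ≃g X | g.symm w = y}) ∈ U := by
      filter_upwards [hK] with g hg
      exact Set.mem_biUnion ⟨g.symm, by rw [RelIso.symm_apply_eq]; exact hg.symm, rfl⟩ rfl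
    obtain ⟨y, _, hy⟩ := (Ultrafilter.finite_biUnion_mem_iff (finite_orbit_stabilizer hX v w)).mp h1
    exact ⟨y, hy⟩
  choose φ hφ using hφ
  choose ψ hψ using hψ
  let g₀ : X ≃g X :=
    { toFun := φ
      invFun := ψ
      left_inv := fun w => by
        obtain ⟨g, h1, h2⟩ := ((hφ w).and (hψ (φ w))).exists
        rw [← h2, ← h1, RelIso.symm_apply_apply]
      right_inv := fun w => by
        obtain ⟨g, h1, h2⟩ := ((hψ w).and (hφ (ψ w))).exists
        rw [← h2, ← h1, RelIso.apply_symm_apply]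
      map_rel_iff' := fun {a b} => by
        obtain ⟨g, h1, h2⟩ := ((hφ a).and (hφ b)).exists
        change X.Adj (φ a) (φ b) ↔ _
        rw [← h1, ← h2, g.map_adj_iff] }
  have hφv : φ v = v := by
    obtain ⟨g, h1, h2⟩ := ((hφ v).and hK).exists
    exact h1.symm.trans h2
  refine ⟨g₀, hφv, fun N hN => ?_⟩
  obtain ⟨O, hON, hO, hg₀⟩ := mem_nhds_iff.mp hN
  obtain ⟨F, hF⟩ := exists_finset_of_isOpen_aut hO hg₀
  have : ∀ᶠ g : X ≃g X in U, ∀ w ∈ F, g w = φ w :=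
    (Filter.eventually_all_finset F).mpr fun w _ => hφ w
  filter_upwards [this] with g hg
  exact hON (hF g hg)

theorem isCompact_stabilizer [X.LocallyFinite] (hX : X.Connected) {G : Subgroup (X ≃g X)}
    (hG : IsClosed (G : Set (X ≃g X))) (v : V) : IsCompact {g : G | g • v = v} :=
  hG.isClosedEmbedding_subtypeVal.isCompact_preimage (isCompact_stabilizer_aut hX v)

end Compact

/-! ### Approximation by functions that are invariant under an open subgroup -/

section Density

variable {V : Type*} {X : SimpleGraph V} {G : Subgroup (X ≃g X)} {Γ : Subgroup G}

/-- `φ` is invariant under right translation by the pointwise stabilizer of `F`. -/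
def IsInvariantUnder {α : Type*} (F : Finset V) (φ : RightCosets Γ → α) : Prop :=
  ∀ u : G, (∀ v ∈ F, u • v = v) → ∀ x, φ (RightCosets.translate Γ u x) = φ x

theorem IsInvariantUnder.mono {α : Type*} {F F' : Finset V} {φ : RightCosets Γ → α}
    (h : IsInvariantUnder F φ) (hF : F ⊆ F') : IsInvariantUnder F' φ :=
  fun u hu => h u fun v hv => hu v (hF hv)

theorem exists_isInvariantUnder_mem {O : Set (RightCosets Γ)} (hO : IsOpen O) {x : RightCosets Γ}
    (hx : x ∈ O) : ∃ (B : Set (RightCosets Γ)) (F : Finset V),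
      IsOpen B ∧ IsInvariantUnder F (· ∈ B) ∧ x ∈ B ∧ B ⊆ O := by
  obtain ⟨g, rfl⟩ := RightCosets.exists_rep Γ x
  have hO' : IsOpen ((fun g : G => (Quotient.mk _ g : RightCosets Γ)) ⁻¹' O) := hO
  obtain ⟨F, hF⟩ := exists_finset_of_isOpen hO' hx
  let B : Set (RightCosets Γ) := {y | ∃ h : G, Quotient.mk _ h = y ∧ ∀ v ∈ F, h • v = g • v}
  have htrans : ∀ u : G, (∀ v ∈ F, u • v = v) → ∀ y ∈ B, RightCosets.translate Γ u y ∈ B := by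
    rintro u hu y ⟨h, rfl, hh⟩
    exact ⟨h * u, rfl, fun v hv => by rw [mul_smul, hu v hv, hh v hv]⟩
  refine ⟨B, F, ?_, fun u hu y => propext ⟨fun h => ?_, htrans u hu y⟩, ⟨g, rfl, fun _ _ => rfl⟩, ?_⟩
  · have h1 : IsOpen ((fun g : G => (Quotient.mk _ g : RightCosets Γ)) ⁻¹' B) := by
      have h2 : (fun g : G => (Quotient.mk _ g : RightCosets Γ)) ⁻¹' B =
          ⋃ γ : Γ, ⋂ v ∈ F, {k : G | k • v = γ⁻¹ • g • v} := by
        ext k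
        simp only [Set.mem_iUnion, Set.mem_iInter, Set.mem_ofPred_eq, B]
        constructor
        · rintro ⟨h, hhk, hh⟩
          have h3 := QuotientGroup.rightRel_apply.mp (Quotient.exact hhk)
          refine ⟨⟨k * h⁻¹, h3⟩⁻¹, fun v hv => ?_⟩
          rw [inv_inv, ← hh v hv]
          change k • v = (k * h⁻¹) • h • v
          rw [smul_smul, inv_mul_cancel_right]
        · rintro ⟨γ, hγ⟩
          refine ⟨γ * k, ?_, fun v hv => ?_⟩
          · refine Quotient.sound (QuotientGroup.rightRel_apply.mpr ?_)
            simp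
          · rw [mul_smul, hγ v hv]
            exact smul_inv_smul γ _
      rw [h2]
      exact isOpen_iUnion fun γ => F.finite_toSet.isOpen_biInter fun v _ =>
        isOpen_setOf_smul_vertex_eq v _
    exact h1
  · have := htrans u⁻¹ (fun v hv => by rw [inv_smul_eq_iff, hu v hv]) _ h
    rwa [← Function.comp_apply (f := RightCosets.translate Γ u⁻¹), ← RightCosets.translate_mul,
      mul_inv_cancel, RightCosets.translate_one] at this
  · rintro y ⟨h, rfl, hh⟩
    exact hF h hh

variable {μ : Measure (RightCosets Γ)}

theorem exists_isInvariantUnder_measure_symmDiff_lt [IsFiniteMeasure μ] [μ.Regular]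
    {s : Set (RightCosets Γ)} (hs : MeasurableSet s) {ε : ℝ≥0∞} (hε : ε ≠ 0) :
    ∃ (B : Set (RightCosets Γ)) (F : Finset V),
      MeasurableSet B ∧ IsInvariantUnder F (· ∈ B) ∧ μ (symmDiff B s) < ε := by
  classical
  have hε2 : ε / 2 ≠ 0 := by simpa using hε
  obtain ⟨O, hsO, hO, hμO⟩ := s.exists_isOpen_lt_add (measure_ne_top μ s) hε2
  obtain ⟨C, hCs, hC, hμC⟩ := hs.exists_isCompact_lt_add (measure_ne_top μ s) hε2
  obtain ⟨B, F, hB, hBF, hCB, hBO⟩ : ∃ (B : Set (RightCosets Γ)) (F : Finset V),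
      IsOpen B ∧ IsInvariantUnder F (· ∈ B) ∧ C ⊆ B ∧ B ⊆ O := by
    refine hC.induction_on (p := fun C => ∃ (B : Set (RightCosets Γ)) (F : Finset V),
      IsOpen B ∧ IsInvariantUnder F (· ∈ B) ∧ C ⊆ B ∧ B ⊆ O) ?_ ?_ ?_ ?_
    · exact ⟨∅, ∅, isOpen_empty, fun u _ x => rfl, subset_rfl, Set.empty_subset _⟩
    · rintro s t hst ⟨B, F, h1, h2, h3, h4⟩
      exact ⟨B, F, h1, h2, hst.trans h3, h4⟩
    · rintro s t ⟨B, F, h1, h2, h3, h4⟩ ⟨B', F', h1', h2', h3', h4'⟩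
      refine ⟨B ∪ B', F ∪ F', h1.union h1', fun u hu x => ?_, Set.union_subset_union h3 h3',
        Set.union_subset h4 h4'⟩
      exact congrArg₂ Or (h2.mono Finset.subset_union_left u hu x)
        (h2'.mono Finset.subset_union_right u hu x)
    · intro x hx
      obtain ⟨B, F, h1, h2, h3, h4⟩ := exists_isInvariantUnder_mem hO (hsO (hCs hx))
      exact ⟨B, mem_nhdsWithin_of_mem_nhds (h1.mem_nhds h3), B, F, h1, h2, subset_rfl, h4⟩
  refine ⟨B, F, hB.measurableSet, hBF, ?_⟩
  have h1 : μ (B \ s) < ε / 2 := (measure_mono (Set.sdiff_subset_sdiff_left hBO)).trans_lt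
    (measure_sdiff_lt_of_lt_add hs.nullMeasurableSet hsO (measure_ne_top μ s) hμO)
  have h2 : μ (s \ B) < ε / 2 := by
    rw [← Set.sdiff_inter_self_eq_sdiff, Set.inter_comm]
    refine measure_sdiff_lt_of_lt_add (hs.inter hB.measurableSet).nullMeasurableSet
      Set.inter_subset_left (measure_ne_top μ _) (hμC.trans_le ?_)
    gcongr
    exact Set.subset_inter hCs hCB
  calc μ (symmDiff B s) ≤ μ (B \ s) + μ (s \ B) := measure_union_le _ _
    _ < ε / 2 + ε / 2 := ENNReal.add_lt_add h1 h2
    _ = ε := ENNReal.add_halves ε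

/-- The elements of `L²(Γ\G)` that are represented by a function invariant under the pointwise
stabilizer of a finite set of vertices. -/
def smoothVectors (μ : Measure (RightCosets Γ)) : Submodule ℂ (Lp ℂ 2 μ) where
  carrier := {ξ | ∃ (φ : RightCosets Γ → ℂ) (F : Finset V), IsInvariantUnder F φ ∧ ξ =ᵐ[μ] φ}
  zero_mem' := ⟨0, ∅, fun _ _ _ => rfl, Lp.coeFn_zero ℂ 2 μ⟩
  add_mem' := by
    classical
    rintro ξ η ⟨φ, F, hφ, hξ⟩ ⟨ψ, F', hψ, hη⟩
    refine ⟨φ + ψ, F ∪ F', fun u hu x => ?_, (Lp.coeFn_add ξ η).trans (hξ.add hη)⟩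
    exact congrArg₂ (· + ·) (hφ.mono Finset.subset_union_left u hu x)
      (hψ.mono Finset.subset_union_right u hu x)
  smul_mem' := by
    rintro c ξ ⟨φ, F, hφ, hξ⟩
    exact ⟨c • φ, F, fun u hu x => congrArg (c • ·) (hφ u hu x),
      (Lp.coeFn_smul c ξ).trans (hξ.const_smul c)⟩

/-- Smooth vectors are dense. -/
theorem mem_closure_smoothVectors [IsFiniteMeasure μ] [μ.Regular] (ξ : Lp ℂ 2 μ) :
    ξ ∈ (smoothVectors μ).topologicalClosure := by
  refine Lp.induction ENNReal.ofNat_ne_top (motive := fun ξ => ξ ∈ (smoothVectors μ).topologicalClosure)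
    ?_ (fun f g _ _ _ hf hg => add_mem hf hg) (Submodule.isClosed_topologicalClosure _) ξ
  intro c s hs hμs
  have hε : ∀ n : ℕ, ((n : ℝ≥0∞) + 1)⁻¹ ≠ 0 := fun n => by simp
  choose B F hB hBF hBs using fun n : ℕ =>
    exists_isInvariantUnder_measure_symmDiff_lt (μ := μ) hs (hε n)
  have hlim : Filter.Tendsto (fun n => μ (symmDiff (B n) s)) Filter.atTop (𝓝 0) := by
    refine tendsto_of_tendsto_of_tendsto_of_le_of_le tendsto_const_nhds ?_
      (fun n => zero_le) (fun n => (hBs n).le)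
    have := (ENNReal.tendsto_inv_nat_nhds_zero).comp (Filter.tendsto_add_atTop_nat 1)
    simpa [Function.comp_def] using this
  have hlim' := tendsto_indicatorConstLp_set (p := 2) (c := c) (hs := hs) (ht := hB)
    (hμs := measure_ne_top μ s) (hμt := fun n => measure_ne_top μ (B n)) ENNReal.ofNat_ne_top hlim
  rw [Lp.simpleFunc.coe_indicatorConst]
  refine mem_closure_of_tendsto hlim' (.of_forall fun n => ?_)
  refine ⟨(B n).indicator fun _ => c, F n, fun u hu x => ?_, indicatorConstLp_coeFn⟩
  have h1 : RightCosets.translate Γ u x ∈ B n ↔ x ∈ B n := iff_of_eq (hBF n u hu x)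
  by_cases hx : x ∈ B n
  · rw [Set.indicator_of_mem hx, Set.indicator_of_mem (h1.mpr hx)]
  · rw [Set.indicator_of_notMem hx, Set.indicator_of_notMem fun h => hx (h1.mp h)]

end Density

/-! ### The Poincaré inequality implies a spectral gap -/

section Average

universe u

variable {V : Type u} {X : SimpleGraph V} {G : Subgroup (X ≃g X)} {Γ : Subgroup G}

theorem translate_translate (g h : G) (x : RightCosets Γ) :
    RightCosets.translate Γ h (RightCosets.translate Γ g x) = RightCosets.translate Γ (g * h) x := by
  rw [RightCosets.translate_mul]; rfl

/-- Functions invariant under the stabilizer of `v` are functions on the orbit of `v` in `Γ\X`. -/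
theorem exists_eq_comp_orbitMap {φ : RightCosets Γ → ℂ} {v : V}
    (hφ : ∀ k : G, k • v = v → ∀ x, φ (RightCosets.translate Γ k x) = φ x) :
    ∃ f : QuotV Γ → ℂ, φ = f ∘ orbitMap Γ v := by
  have hfac : φ.FactorsThrough (orbitMap Γ v) := by
    intro x y hxy
    obtain ⟨g, rfl⟩ := RightCosets.exists_rep Γ x
    obtain ⟨h, rfl⟩ := RightCosets.exists_rep Γ y
    obtain ⟨γ, hγ⟩ := Quotient.exact hxy
    have hγ : (γ : G) • h • v = g • v := hγ
    have h1 := hφ (g⁻¹ * (γ * h)) (by rw [mul_smul, mul_smul, hγ, inv_smul_smul]) (Quotient.mk _ g)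
    rw [← h1]
    refine congrArg φ (Quotient.sound (QuotientGroup.rightRel_apply.mpr ?_))
    simp
  exact ⟨Function.extend (orbitMap Γ v) φ 0, funext fun x => (hfac.extend_apply 0 x).symm⟩

variable {μ : Measure (RightCosets Γ)}

/-- A smooth vector can be averaged over the stabilizer of `v`: there are finitely many elements of
the stabilizer such that the mean of its translates by these elements is invariant. -/
theorem exists_average [X.LocallyFinite] (hX : X.Connected) (hμ : IsFiniteInvariantMeasure Γ μ)
    (v : V) {Φ : Lp ℂ 2 μ} (hΦ : Φ ∈ smoothVectors μ) :
    ∃ (ι : Type u) (_ : Fintype ι) (_ : Nonempty ι) (k : ι → G) (f : QuotV Γ → ℂ),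
      (∀ i, k i • v = v) ∧
      ((Fintype.card ι : ℝ)⁻¹ • ∑ i, rho hμ (k i) Φ : Lp ℂ 2 μ) =ᵐ[μ] f ∘ orbitMap Γ v := by
  obtain ⟨φ, F, hφ, hΦφ⟩ := hΦ
  -- the orbit of the enumeration of `F` under the stabilizer is finite
  let a : F → V := fun w => w
  let O := MulAction.orbit (MulAction.stabilizer G v) a
  have hO : O.Finite := by
    refine (Set.Finite.pi fun w : F => finite_orbit_stabilizer hX v w).subset ?_
    rintro _ ⟨k, rfl⟩ w _
    exact ⟨k.1, k.2, rfl⟩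
  let _ : Fintype O := hO.fintype
  have hk : ∀ b : O, ∃ k : MulAction.stabilizer G v, k • a = b := fun b => b.2
  choose k hk using hk
  have hφk : ∀ k k' : MulAction.stabilizer G v, k • a = k' • a → ∀ x,
      φ (RightCosets.translate Γ k x) = φ (RightCosets.translate Γ k' x) := by
    intro k k' h x
    have h1 := hφ ((k'⁻¹ * k : MulAction.stabilizer G v) : G) (fun w hw => ?_)
      (RightCosets.translate Γ k' x)
    · rw [← h1, translate_translate]
      congr 2
      simp
    · have h2 : (k : G) • w = (k' : G) • w := congrFun h ⟨w, hw⟩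
      have h3 : ((k'⁻¹ * k : MulAction.stabilizer G v) : G) = (k' : G)⁻¹ * k := rfl
      rw [h3, mul_smul, h2, inv_smul_smul]
  let φ' : RightCosets Γ → ℂ := fun x =>
    ((Fintype.card O : ℝ)⁻¹ : ℝ) • ∑ b, φ (RightCosets.translate Γ (k b) x)
  have hφ' : ∀ u : G, u • v = v → ∀ x, φ' (RightCosets.translate Γ u x) = φ' x := by
    intro u hu x
    refine congrArg (((Fintype.card O : ℝ)⁻¹ : ℝ) • ·) ?_
    let u' : MulAction.stabilizer G v := ⟨u, hu⟩
    refine Fintype.sum_equiv (MulAction.toPerm u') _ _ fun b => ?_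
    rw [translate_translate]
    refine hφk (u' * k b) _ ?_ x
    rw [hk, mul_smul, hk]
    rfl
  obtain ⟨f, hf⟩ := exists_eq_comp_orbitMap hφ'
  refine ⟨O, inferInstance, ⟨⟨a, MulAction.mem_orbit_self a⟩⟩, fun b => k b, f, fun b => (k b).2, ?_⟩
  rw [← hf]
  have h1 : ∀ b, rho hμ (k b) Φ =ᵐ[μ] φ ∘ RightCosets.translate Γ (k b) := fun b =>
    (Lp.coeFn_compMeasurePreserving Φ (hμ.invariant (k b))).trans
      ((hμ.invariant (k b)).quasiMeasurePreserving.ae_eq_comp hΦφ)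
  have h2 := Lp.coeFn_smul ((Fintype.card O : ℝ)⁻¹) (∑ b, rho hμ (k b) Φ)
  have h3 := Lp.coeFn_fun_finsetSum Finset.univ fun b => rho hμ (k b) Φ
  filter_upwards [h2, h3, ae_all_iff.mpr h1] with x h2 h3 h1
  rw [h2, Pi.smul_apply, h3]
  simp only [h1]
  rfl

/-- A vector that is almost invariant under the stabilizer of `v` is close to a function on the orbit
of `v` in `Γ\X`. -/
theorem exists_near_of_almost_invariant [X.LocallyFinite] (hX : X.Connected)
    (hμ : IsFiniteInvariantMeasure Γ μ) (v : V) {ξ : Lp ℂ 2 μ} {ε : ℝ} (hε : 0 < ε)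
    (h : ∀ k : G, k • v = v → ‖rho hμ k ξ - ξ‖ ≤ ε) :
    ∃ (f : QuotV Γ → ℂ) (Φ : Lp ℂ 2 μ), Φ =ᵐ[μ] f ∘ orbitMap Γ v ∧ ‖Φ - ξ‖ ≤ 2 * ε := by
  have := hμ.finite
  have := hμ.regular
  obtain ⟨Φ, hΦ, hd⟩ := Metric.mem_closure_iff.mp (mem_closure_smoothVectors ξ) ε hε
  obtain ⟨ι, _, _, k, f, hk, hf⟩ := exists_average hX hμ v hΦ
  refine ⟨f, _, hf, ?_⟩
  have hball : ∀ i, rho hμ (k i) Φ ∈ Metric.closedBall ξ (2 * ε) := by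
    intro i
    rw [mem_closedBall_iff_norm]
    have h1 : ‖rho hμ (k i) (Φ - ξ)‖ = ‖Φ - ξ‖ :=
      Lp.norm_compMeasurePreserving (Φ - ξ) (hμ.invariant (k i))
    rw [map_sub] at h1
    rw [dist_comm, dist_eq_norm] at hd
    have h2 := norm_add_le (rho hμ (k i) Φ - rho hμ (k i) ξ) (rho hμ (k i) ξ - ξ)
    rw [sub_add_sub_cancel] at h2
    linarith [h (k i) (hk i)]
  have hcard : (Fintype.card ι : ℝ) ≠ 0 := by exact_mod_cast Fintype.card_ne_zero
  have := (convex_closedBall ξ (2 * ε)).sum_mem (t := Finset.univ)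
    (w := fun _ : ι => (Fintype.card ι : ℝ)⁻¹) (fun _ _ => by positivity)
    (by simp [hcard]) (fun i _ => hball i)
  rwa [← Finset.smul_sum, mem_closedBall_iff_norm] at this

/-- A vector of integral zero is orthogonal to the constants. -/
theorem norm_le_norm_sub_const [IsFiniteMeasure μ] {ξ : Lp ℂ 2 μ} (hξ : ∫ x, ξ x ∂μ = 0) (a : ℂ) :
    ‖ξ‖ ≤ ‖ξ - Lp.const 2 μ a‖ := by
  have h1 : ⟪Lp.const 2 μ a, ξ⟫_ℂ = 0 := by
    rw [← indicatorConstLp_univ, L2.inner_indicatorConstLp_eq_inner_setIntegral, setIntegral_univ,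
      hξ, inner_zero_right]
  have h2 : ‖ξ - Lp.const 2 μ a‖ ^ 2 = ‖ξ‖ ^ 2 + ‖Lp.const 2 μ a‖ ^ 2 := by
    rw [@norm_sub_sq ℂ, inner_eq_zero_symm.mp h1]; simp
  refine le_of_sq_le_sq ?_ (norm_nonneg _)
  rw [h2]
  nlinarith [sq_nonneg ‖Lp.const 2 μ a‖]

end Average

section Gap

variable {V : Type*} {X : SimpleGraph V} {G : Subgroup (X ≃g X)} {Γ : Subgroup G}
  {μ : Measure (RightCosets Γ)}

/-- A vector that is almost invariant under the stabilizers of two adjacent vertices `v` and `w`, and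
under an element `h` with `hv = w` if there is one, is close to `f ∘ p` for one and the same function
`f` on the vertices of `Γ\X`, both for the orbit map `p` of `v` and for that of `w`. -/
theorem exists_near_pair [X.LocallyFinite] (hX : X.Connected)
    (hμ : IsFiniteInvariantMeasure Γ μ) (v w : V) : ∃ h : G, ∀ {ξ : Lp ℂ 2 μ} {ε : ℝ}, 0 < ε →
      (∀ k : G, k • v = v ∨ k • w = w ∨ k = h → ‖rho hμ k ξ - ξ‖ ≤ ε) →
      ∃ (f : QuotV Γ → ℂ) (Φ Ψ : Lp ℂ 2 μ), Φ =ᵐ[μ] f ∘ orbitMap Γ v ∧ Ψ =ᵐ[μ] f ∘ orbitMap Γ w ∧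
        ‖Φ - ξ‖ ≤ 3 * ε ∧ ‖Ψ - ξ‖ ≤ 3 * ε := by
  classical
  by_cases hvw : ∃ h : G, h • v = w
  · obtain ⟨h, rfl⟩ := hvw
    refine ⟨h, fun {ξ ε} hε hk => ?_⟩
    obtain ⟨f, Φ, hΦ, hle⟩ := exists_near_of_almost_invariant hX hμ v hε
      fun k hkv => hk k (Or.inl hkv)
    refine ⟨f, Φ, rho hμ h Φ, hΦ, ?_, by linarith, ?_⟩
    · rw [orbitMap_smul]
      exact (Lp.coeFn_compMeasurePreserving Φ (hμ.invariant h)).trans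
        ((hμ.invariant h).quasiMeasurePreserving.ae_eq_comp hΦ)
    · have h1 : ‖rho hμ h (Φ - ξ)‖ = ‖Φ - ξ‖ :=
        Lp.norm_compMeasurePreserving (Φ - ξ) (hμ.invariant h)
      rw [map_sub] at h1
      have h2 := norm_add_le (rho hμ h Φ - rho hμ h ξ) (rho hμ h ξ - ξ)
      rw [sub_add_sub_cancel] at h2
      linarith [hk h (Or.inr (Or.inr rfl))]
  · refine ⟨1, fun {ξ ε} hε hk => ?_⟩
    obtain ⟨f, Φ, hΦ, hΦle⟩ := exists_near_of_almost_invariant hX hμ v hε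
      fun k hkv => hk k (Or.inl hkv)
    obtain ⟨f', Ψ, hΨ, hΨle⟩ := exists_near_of_almost_invariant hX hμ w hε
      fun k hkw => hk k (Or.inr (Or.inl hkw))
    -- the orbit maps have disjoint ranges, so that the two functions can be glued
    have hdisj : ∀ x y, orbitMap Γ w x ≠ orbitMap Γ v y := by
      intro x y hxy
      obtain ⟨g, rfl⟩ := RightCosets.exists_rep Γ x
      obtain ⟨g', rfl⟩ := RightCosets.exists_rep Γ y
      obtain ⟨γ, hγ⟩ := Quotient.exact hxy
      have hγ : (γ : G) • g' • v = g • w := hγ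
      exact hvw ⟨g⁻¹ * (γ * g'), by rw [mul_smul, mul_smul, hγ, inv_smul_smul]⟩
    refine ⟨fun q => if q ∈ Set.range (orbitMap Γ v) then f q else f' q, Φ, Ψ, hΦ.trans ?_,
      hΨ.trans ?_, by linarith, by linarith⟩
    · refine .of_forall fun x => ?_
      simp
    · refine .of_forall fun x => ?_
      simp only [Function.comp_apply]
      rw [if_neg]
      rintro ⟨y, hy⟩
      exact hdisj x y hy.symm

variable [X.LocallyFinite] [MeasurableSpace (QuotE Γ)] [DiscreteMeasurableSpace (QuotE Γ)]
  [MeasurableSpace (QuotV Γ)] [DiscreteMeasurableSpace (QuotV Γ)]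

/-- A unit vector `ξ` of mean zero that is almost invariant is close to `f ∘ p₀` and to `f ∘ p₁`, where
`p₀` and `p₁` are the orbit maps of the ends of `d₀`. Then the gradient of `f` is small, hence by the
Poincaré inequality `f ∘ p₀`, and so `ξ`, is close to a constant, which is absurd. -/
theorem hasSpectralGap_of_poincare (hX : X.Connected) (hGclosed : IsClosed (G : Set (X ≃g X)))
    (hΓ : DiscreteTopology Γ) (hG : LocallyInftyTransitive G) (hμ : IsFiniteInvariantMeasure Γ μ)
    (d₀ : X.Dart) (hP : (quotientDiagram Γ hX hΓ).Poincare) : HasSpectralGap hμ := by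
  have hfin := hμ.finite
  have hV : Countable V := countable_of_connected hX
  set D := quotientDiagram Γ hX hΓ with hD
  obtain ⟨K, hK, hcomp, hvert⟩ := exists_norm_comparison hX hΓ hG hμ d₀
  obtain ⟨C, hP⟩ := hP
  obtain ⟨h, hnear⟩ := exists_near_pair hX hμ d₀.fst d₀.snd
  intro hai
  have hQ : IsCompact ({g : G | g • d₀.fst = d₀.fst} ∪ ({g : G | g • d₀.snd = d₀.snd} ∪ {h})) :=
    (isCompact_stabilizer hX hGclosed _).union
      ((isCompact_stabilizer hX hGclosed _).union isCompact_singleton)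
  -- the distance of `ξ` to the constants will turn out to be at most `3ε + 12Cε = 1 / 2`
  set ε : ℝ := 1 / (2 * (3 + 12 * C)) with hε
  have hε0 : 0 < ε := by positivity
  obtain ⟨⟨ξ, hξ⟩, hξ1, hξQ⟩ := hai _ hQ ε hε0
  have hξ : ∫ x, ξ x ∂μ = 0 := hξ
  have hξ1 : ‖ξ‖ = 1 := hξ1
  obtain ⟨f, Φ, Ψ, hΦ, hΨ, hΦξ, hΨξ⟩ := hnear (ξ := ξ) hε0 fun k hk => (hξQ k hk).le
  have hΦΨ : ‖Φ - Ψ‖ ≤ 6 * ε := by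
    have := norm_sub_le_norm_sub_add_norm_sub Φ ξ Ψ
    rw [norm_sub_rev ξ Ψ] at this
    linarith
  have hgrad : K * eLpNorm (fun e => f (D.src e) - f (D.tgt e)) 2 D.edgeMeasure ≤
      2 * ‖Φ - Ψ‖ₑ := by
    have h1 := (hcomp fun e => f (D.src e) - f (D.tgt e)).2
    have h2 : eLpNorm ((fun e => f (D.src e) - f (D.tgt e)) ∘ orbitMap Γ d₀) 2 μ = ‖Φ - Ψ‖ₑ := by
      rw [Lp.enorm_def]
      refine eLpNorm_congr_ae ?_
      filter_upwards [hΦ, hΨ, Lp.coeFn_sub Φ Ψ] with x h1 h2 h3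
      rw [h3, Pi.sub_apply, h1, h2, ← src_orbitMap hX hΓ, ← tgt_orbitMap hX hΓ]
      rfl
    have h3 : eLpNorm ((fun e => f (D.src e) - f (D.tgt e)) ∘ orbitMap Γ d₀.symm) 2 μ =
        ‖Φ - Ψ‖ₑ := by
      rw [enorm_sub_rev, Lp.enorm_def]
      refine eLpNorm_congr_ae ?_
      filter_upwards [hΦ, hΨ, Lp.coeFn_sub Ψ Φ] with x h1 h2 h3
      rw [h3, Pi.sub_apply, h1, h2]
      have h4 := congrFun (src_orbitMap hX hΓ d₀.symm) x
      have h5 := congrFun (tgt_orbitMap hX hΓ d₀.symm) x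
      change f (D.src (orbitMap Γ d₀.symm x)) - f (D.tgt (orbitMap Γ d₀.symm x)) = _
      exact congrArg₂ (fun a b => f a - f b) h4 h5
    rw [h2, h3, ← two_mul] at h1
    exact h1
  have hmem : MemLp f 2 D.vertexMeasure := by
    refine ⟨by fun_prop, ?_⟩
    have h1 := (hvert f).2
    rw [← eLpNorm_congr_ae hΦ, ← eLpNorm_congr_ae hΨ, ← Lp.enorm_def, ← Lp.enorm_def] at h1
    have h2 := h1.trans_lt (ENNReal.add_lt_top.mpr ⟨enorm_lt_top, enorm_lt_top⟩)
    exact (ENNReal.mul_lt_top_iff.mp h2).elim (fun h => h.2) fun h => h.elim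
      (fun h => absurd h (by exact_mod_cast hK)) fun h => h ▸ ENNReal.zero_lt_top
  obtain ⟨a, ha⟩ := hP f hmem
  have hconst : ‖Φ - Lp.const 2 μ a‖ₑ ≤ C * (2 * ‖Φ - Ψ‖ₑ) := by
    have h1 : ‖Φ - Lp.const 2 μ a‖ₑ = eLpNorm ((fun q => f q - a) ∘ orbitMap Γ d₀.fst) 2 μ := by
      rw [Lp.enorm_def]
      refine eLpNorm_congr_ae ?_
      filter_upwards [hΦ, Lp.coeFn_const (p := 2) (μ := μ) a, Lp.coeFn_sub Φ (Lp.const 2 μ a)]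
        with x h1 h2 h3
      rw [h3, Pi.sub_apply, h1, h2]
      rfl
    calc ‖Φ - Lp.const 2 μ a‖ₑ ≤ K * eLpNorm (fun q => f q - a) 2 D.vertexMeasure :=
          h1.le.trans (hvert _).1
      _ ≤ K * (C * eLpNorm (fun e => f (D.src e) - f (D.tgt e)) 2 D.edgeMeasure) := by gcongr
      _ = C * (K * eLpNorm (fun e => f (D.src e) - f (D.tgt e)) 2 D.edgeMeasure) :=
          mul_left_comm _ _ _
      _ ≤ C * (2 * ‖Φ - Ψ‖ₑ) := by gcongr
  have hconst' : ‖Φ - Lp.const 2 μ a‖ ≤ C * (2 * ‖Φ - Ψ‖) := by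
    simpa using ENNReal.toReal_mono (by finiteness) hconst
  have h1 := norm_le_norm_sub_const hξ a
  have h2 := norm_sub_le_norm_sub_add_norm_sub ξ Φ (Lp.const 2 μ a)
  rw [norm_sub_rev ξ Φ] at h2
  have h3 : (C : ℝ) * (2 * ‖Φ - Ψ‖) ≤ C * (2 * (6 * ε)) := by gcongr
  have h4 : (3 + 12 * C) * ε = 1 / 2 := by
    rw [hε]; field_simp
  linarith

end Gap

/-! ### Finite volume and the degrees of `Γ\X` -/

section Volume

variable {V : Type*} {X : SimpleGraph V} {G : Subgroup (X ≃g X)} {Γ : Subgroup G}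
  {μ : Measure (RightCosets Γ)} [X.LocallyFinite]
  [MeasurableSpace (QuotE Γ)] [DiscreteMeasurableSpace (QuotE Γ)]
  [MeasurableSpace (QuotV Γ)]

theorem isFiniteMeasure_vertexMeasure (hX : X.Connected) (hΓ : DiscreteTopology Γ)
    (hG : LocallyInftyTransitive G) (hμ : IsFiniteInvariantMeasure Γ μ) (d₀ : X.Dart) :
    IsFiniteMeasure (quotientDiagram Γ hX hΓ).vertexMeasure := by
  have hfin := hμ.finite
  obtain ⟨c, hc, h⟩ := exists_map_add_map_eq hX hΓ hG hμ d₀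
  have h1 : IsFiniteMeasure (c⁻¹ • c • (quotientDiagram Γ hX hΓ).edgeMeasure) := by
    rw [← h]; infer_instance
  rw [inv_smul_smul₀ hc] at h1
  exact Measure.isFiniteMeasure_map _ _

/-- The total mass of `μ` is finite because the weights `indeg` are bounded below. -/
theorem hasFiniteVolume_of_isFiniteMeasure [DiscreteMeasurableSpace (QuotV Γ)] (hX : X.Connected) (hΓ : DiscreteTopology Γ)
    [IsFiniteMeasure (quotientDiagram Γ hX hΓ).vertexMeasure] {a b : ℝ} (ha : 0 < a)
    (hab : ∀ x, a ≤ (quotientDiagram Γ hX hΓ).indeg x ∧ (quotientDiagram Γ hX hΓ).indeg x ≤ b) :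
    (quotientDiagram Γ hX hΓ).HasFiniteVolume := by
  have hV : Countable V := countable_of_connected hX
  have h1 := (Diagram.memL2_iff ha hab fun _ => 1).mpr (memLp_const 1)
  simpa [Diagram.MemL2, Diagram.HasFiniteVolume] using h1

theorem exists_degree_bounds
    (hG : (∃ k : ℕ, 3 ≤ k ∧ X.IsRegularOfDegree k ∧ TransitiveOn G Set.univ) ∨
      (∃ (S : Set V) (k₀ k₁ : ℕ), 3 ≤ k₀ ∧ 3 ≤ k₁ ∧ IsBiregular X S k₀ k₁ ∧
        TransitiveOn G S ∧ TransitiveOn G Sᶜ)) :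
    ∃ b : ℕ, ∀ v, 1 ≤ X.degree v ∧ X.degree v ≤ b := by
  rcases hG with ⟨k, hk, hreg, _⟩ | ⟨S, k₀, k₁, h₀, h₁, hbi, _⟩
  · exact ⟨k, fun v => by rw [hreg v]; omega⟩
  · refine ⟨k₀ + k₁, fun v => ?_⟩
    by_cases hv : v ∈ S
    · rw [hbi.degree_of_mem v hv]; omega
    · rw [hbi.degree_of_notMem v hv]; omega

end Volume

end TreeLattice

end

theorem proposition1 {V : Type*} (X : SimpleGraph V) [X.LocallyFinite] (hX : X.IsTree)
    (G : Subgroup (X ≃g X)) (hGclosed : IsClosed (G : Set (X ≃g X)))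
    (hG : (∃ k : ℕ, 3 ≤ k ∧ X.IsRegularOfDegree k ∧ TransitiveOn G Set.univ) ∨
      (∃ (S : Set V) (k₀ k₁ : ℕ), 3 ≤ k₀ ∧ 3 ≤ k₁ ∧ IsBiregular X S k₀ k₁ ∧
        TransitiveOn G S ∧ TransitiveOn G Sᶜ))
    (hGtrans : LocallyInftyTransitive G)
    (Γ : Subgroup G) (hΓ : IsLattice Γ)
    (μ : MeasureTheory.Measure (RightCosets Γ)) (hμ : IsFiniteInvariantMeasure Γ μ) :
    (quotientDiagram Γ hX.1 hΓ.discrete).HasFiniteVolume ∧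
    (HasSpectralGap hμ ↔ 0 < (quotientDiagram Γ hX.1 hΓ.discrete).lambda) ∧
    ((∃ k : ℝ, (quotientDiagram Γ hX.1 hΓ.discrete).IsRegular k) →
      (HasSpectralGap hμ ↔ 0 < (quotientDiagram Γ hX.1 hΓ.discrete).rayleigh)) := by
  let _ : MeasurableSpace (QuotV Γ) := ⊤
  let _ : MeasurableSpace (QuotE Γ) := ⊤
  have hV : Countable V := countable_of_connected hX.1
  obtain ⟨b, hb⟩ := exists_degree_bounds hG
  obtain ⟨v⟩ := hX.1.nonempty
  obtain ⟨w, hvw⟩ := (X.degree_pos_iff_exists_adj v).mp (hb v).1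
  let d₀ : X.Dart := ⟨(v, w), hvw⟩
  have hab : ∀ x, (1 : ℝ) ≤ (quotientDiagram Γ hX.1 hΓ.discrete).indeg x ∧
      (quotientDiagram Γ hX.1 hΓ.discrete).indeg x ≤ b := by
    intro x
    induction x using Quotient.inductionOn with
    | _ u =>
      rw [indeg_mk]
      exact_mod_cast hb u
  have hfin := isFiniteMeasure_vertexMeasure hX.1 hΓ.discrete hGtrans hμ d₀
  have hgap : HasSpectralGap hμ ↔ (quotientDiagram Γ hX.1 hΓ.discrete).Poincare :=
    ⟨poincare_of_hasSpectralGap hX.1 hΓ.discrete hGtrans hμ d₀,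
      hasSpectralGap_of_poincare hX.1 hGclosed hΓ.discrete hGtrans hμ d₀⟩
  refine ⟨hasFiniteVolume_of_isFiniteMeasure hX.1 hΓ.discrete one_pos hab, ?_, ?_⟩
  · rw [hgap, Diagram.lambda_pos_iff one_pos hab fun f hf => eq_of_src_eq_tgt hX.1 hΓ.discrete hf]
  · rintro ⟨k, hk⟩
    have hk0 : 0 < k := by
      rw [← hk (Quotient.mk _ v)]
      exact one_pos.trans_le (hab _).1
    rw [hgap, Diagram.rayleigh_pos_iff hk0 hk]
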